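/- Let $A(x)=x^4$, $$B(x)=-\tfrac{5852770213}{382205952}x^4+\tfrac{89071}{36864}x^3-\tfrac{89233}{1152}x^2-\tfrac92x+144,$$ $$C(x)=\tfrac{34254919166180065369}{584325558976905216}x^4-\tfrac{528356915749387}{28179280429056}x^3+\tfrac{527067904642903}{880602513408}x^2-\tfrac{5881576729}{169869312}x,$$ and let $\mathcal E$ be the curve $y^2=A(x)T^4+B(x)T^2+C(x)$ over $\mathbb Q(T)$. Write $b_3=-\tfrac{5852770213}{764411904}$ for half the leading coefficient of $B$. The coefficient of $x^4$ in $A(x)T^4+B(x)T^2+C(x)$ is $q^2$ with $q=T^2+b_3$, so the smooth projective model of $\mathcal E$ has two rational points at infinity; the one with $y/x^2=q$ is taken as origin. Writing the right-hand side as $q^2x^4+\beta_3x^3+\beta_2x^2+\beta_1x+\beta_0$, let $W_T$ be the Weierstrass curve with $a_1=\beta_3/q$, $a_2=\beta_2-\beta_3^2/(4q^2)$, $a_3=2q\beta_1$, $a_4=-4q^2\beta_0$, $a_6=a_2a_4$, and map $(x,y)$ to $$X=2q(y+qx^2)+\beta_3x,\qquad Y=4q^2(y+qx^2)x+2q(\beta_3x^2+\beta_2x)-\beta_3^2x/(2q),$$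 the origin to $O$, and the other point at infinity to $(-a_2,\,a_1a_2-a_3)$. Then: 1. $B^2-4AC=(x-1)(x+1)(x-4)(x+4)(x-9)(x+9)(x-16)$. 2. The eight points $S_0=(0,12T)$ and $P_{x_i}=\bigl(x_i,\;x_i^2\bigl(T^2+\tfrac{B(x_i)}{2x_i^4}\bigr)\bigr)$, where $x_i\in\{\pm1,\pm4,\pm9,16\}$ runs through the zeros of $B^2-4AC$, lie on $\mathcal E$. 3. The curve $W_T$ is an elliptic curve over $\mathbb Q(T)$, the above map is a bijection from the $\mathbb Q(T)$-points of the smooth model of $\mathcal E$ onto $W_T(\mathbb Q(T))$, the images of the eight points are linearly independent over $\mathbb Z$, and $\mathcal E$ has rank at least $8$ over $\mathbb Q(T)$. 4. The specialization of $\mathcal E$ at $T=1$ is an elliptic curve over $\mathbb Q$ (identified with its Weierstrass model $W_1$ in the same way), with global minimal model $$E_1\colon\ y^2=x^3-x^2-357917711928106838175050781865\,x+8790806811671574287759992288018136706011725.$$ 5. The images on $E_1$ of the eight points specialized at $T=1$ are linearly independent in $E_1(\mathbb Q)$. With the canonical height $\hat h(P)=\lim_{n\to\infty}4^{-n}h(x(2^nP))$,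 where $h(m/n)=\log\max(|m|,n)$ for coprime $m$ and $n\ge1$ (and $h=0$ at the origin), and with the pairing $\langle P,Q\rangle=\tfrac12\bigl(\hat h(P+Q)-\hat h(P)-\hat h(Q)\bigr)$, the determinant of their height matrix is $124079248627.08$ with an error of less than $0.01$ (so about $1.24\cdot10^{11}$). -/

import Mathlib

namespace RankEight

open Polynomial

noncomputable section

/-! ### The curve `y² = A(x) T⁴ + B(x) T² + C(x)` -/

/-- The polynomial `A(x) = x⁴`. -/
def coefA : ℚ[X] := X ^ 4

/-- The polynomial `B(x)`. -/
def coefB : ℚ[X] :=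
  C (-5852770213 / 382205952) * X ^ 4 + C (89071 / 36864) * X ^ 3 + C (-89233 / 1152) * X ^ 2
    + C (-9 / 2) * X + C 144

/-- The polynomial `C(x)`. -/
def coefC : ℚ[X] :=
  C (34254919166180065369 / 584325558976905216) * X ^ 4
    + C (-528356915749387 / 28179280429056) * X ^ 3
    + C (527067904642903 / 880602513408) * X ^ 2 + C (-5881576729 / 169869312) * X

/-- The affine equation `y² = A(x) t⁴ + B(x) t² + C(x)` over a field `F ⊇ ℚ` containing `t`.
For `F = ℚ(T)`, `t = T` it is the generic curve, for `F = ℚ` it is the specialization at `t`. -/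
def OnCurve {F : Type*} [Field F] [Algebra ℚ F] (t x y : F) : Prop :=
  y ^ 2 = aeval x coefA * t ^ 4 + aeval x coefB * t ^ 2 + aeval x coefC

/-- The points of the smooth projective model. The coefficient of `x⁴` in the quartic is the
square of `t² + b₃`, where `2 b₃` is the leading coefficient of `B`, so (when this is nonzero)
there are two rational points at infinity: `infPlus`, where `y / x² = t² + b₃`, and
`infMinus`, where `y / x² = -(t² + b₃)`. -/
inductive CurvePoint {F : Type*} [Field F] [Algebra ℚ F] (t : F) : Type _
  | affine (x y : F) (h : OnCurve t x y) : CurvePoint t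
  | infPlus : CurvePoint t
  | infMinus : CurvePoint t

/-! ### The Weierstrass model -/

/-- The coefficient of `xⁱ` in the quartic `A(x) t⁴ + B(x) t² + C(x)`. -/
def quarticCoeff {F : Type*} [Field F] [Algebra ℚ F] (t : F) (i : ℕ) : F :=
  algebraMap ℚ F (coefA.coeff i) * t ^ 4 + algebraMap ℚ F (coefB.coeff i) * t ^ 2
    + algebraMap ℚ F (coefC.coeff i)

/-- The square root `t² + b₃` of the leading coefficient of the quartic. -/
def leadRoot {F : Type*} [Field F] [Algebra ℚ F] (t : F) : F :=
  t ^ 2 + algebraMap ℚ F (coefB.coeff 4 / 2)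

/-- The Weierstrass cubic attached to the quartic `y² = q² x⁴ + b x³ + c x² + d x + e`, with
`q ≠ 0`; in the coordinates `u = 1 / x`, `v = y / x²` the quartic is
`v² = e u⁴ + d u³ + c u² + b u + q²`, and the point `(u, v) = (0, q)` goes to the origin. -/
def weierstrassOfQuartic {F : Type*} [Field F] (q b c d e : F) : WeierstrassCurve F where
  a₁ := b / q
  a₂ := c - b ^ 2 / (4 * q ^ 2)
  a₃ := 2 * q * d
  a₄ := -4 * q ^ 2 * e
  a₆ := (c - b ^ 2 / (4 * q ^ 2)) * (-4 * q ^ 2 * e)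

/-- The Weierstrass model of the curve `y² = A(x) t⁴ + B(x) t² + C(x)`. -/
def model {F : Type*} [Field F] [Algebra ℚ F] (t : F) : WeierstrassCurve F :=
  weierstrassOfQuartic (leadRoot t) (quarticCoeff t 3) (quarticCoeff t 2) (quarticCoeff t 1)
    (quarticCoeff t 0)

/-- The first coordinate of the image of `(x, y)` on the Weierstrass model:
`(2q(v + q) + b u) / u²` with `u = 1 / x`, `v = y / x²`. -/
def cubicX {F : Type*} [Field F] (q b x y : F) : F :=
  2 * q * (y + q * x ^ 2) + b * x

/-- The second coordinate of the image of `(x, y)` on the Weierstrass model: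
`(4q²(v + q) + 2q(b u + c u²) - b² u² / (2q)) / u³` with `u = 1 / x`, `v = y / x²`. -/
def cubicY {F : Type*} [Field F] (q b c x y : F) : F :=
  4 * q ^ 2 * (y + q * x ^ 2) * x + 2 * q * (b * x ^ 2 + c * x) - b ^ 2 * x / (2 * q)

theorem coeffs_coefA : coefA.coeff 0 = 0 ∧ coefA.coeff 1 = 0 ∧ coefA.coeff 2 = 0 ∧
    coefA.coeff 3 = 0 ∧ coefA.coeff 4 = 1 := by
  simp [coefA, coeff_X_pow]

theorem coeffs_coefB : coefB.coeff 0 = 144 ∧ coefB.coeff 1 = -9 / 2 ∧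
    coefB.coeff 2 = -89233 / 1152 ∧ coefB.coeff 3 = 89071 / 36864 ∧
    coefB.coeff 4 = -5852770213 / 382205952 := by
  simp [coefB, coeff_X_pow, coeff_X, coeff_C, -map_div₀, -map_neg]

theorem coeffs_coefC : coefC.coeff 0 = 0 ∧ coefC.coeff 1 = -5881576729 / 169869312 ∧
    coefC.coeff 2 = 527067904642903 / 880602513408 ∧
    coefC.coeff 3 = -528356915749387 / 28179280429056 ∧
    coefC.coeff 4 = 34254919166180065369 / 584325558976905216 := by
  simp [coefC, coeff_X_pow, coeff_X, -map_div₀, -map_neg]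

theorem onCurve_iff {F : Type*} [Field F] [Algebra ℚ F] (t x y : F) :
    OnCurve t x y ↔ y ^ 2 = leadRoot t ^ 2 * x ^ 4 + quarticCoeff t 3 * x ^ 3
      + quarticCoeff t 2 * x ^ 2 + quarticCoeff t 1 * x + quarticCoeff t 0 := by
  obtain ⟨hA0, hA1, hA2, hA3, hA4⟩ := coeffs_coefA
  obtain ⟨hB0, hB1, hB2, hB3, hB4⟩ := coeffs_coefB
  obtain ⟨hC0, hC1, hC2, hC3, hC4⟩ := coeffs_coefC
  have h : algebraMap ℚ F (34254919166180065369 / 584325558976905216)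
      = algebraMap ℚ F (-5852770213 / 382205952 / 2) ^ 2 := by
    rw [← map_pow]; congr 1; norm_num
  have h2 : algebraMap ℚ F (-5852770213 / 382205952)
      = 2 * algebraMap ℚ F (-5852770213 / 382205952 / 2) := by
    rw [← map_ofNat (algebraMap ℚ F) 2, ← map_mul]; congr 1; norm_num
  rw [OnCurve, leadRoot, quarticCoeff, quarticCoeff, quarticCoeff, quarticCoeff,
    hA0, hA1, hA2, hA3, hB0, hB1, hB2, hB3, hB4, hC0, hC1, hC2, hC3]
  have e : aeval x coefA * t ^ 4 + aeval x coefB * t ^ 2 + aeval x coefC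
      = x ^ 4 * t ^ 4 + (algebraMap ℚ F (-5852770213 / 382205952) * x ^ 4
      + algebraMap ℚ F (89071 / 36864) * x ^ 3 + algebraMap ℚ F (-89233 / 1152) * x ^ 2
      + algebraMap ℚ F (-9 / 2) * x + algebraMap ℚ F 144) * t ^ 2 +
      (algebraMap ℚ F (34254919166180065369 / 584325558976905216) * x ^ 4
      + algebraMap ℚ F (-528356915749387 / 28179280429056) * x ^ 3
      + algebraMap ℚ F (527067904642903 / 880602513408) * x ^ 2
      + algebraMap ℚ F (-5881576729 / 169869312) * x) := by
    simp only [coefA, coefB, coefC, map_add, map_mul, aeval_C, map_pow, aeval_X]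
  rw [e, h, h2, map_zero]
  constructor <;> intro H <;> linear_combination H

/-- Sixteen times the discriminant of a quartic, which is the discriminant of its cubic. -/
theorem weierstrassOfQuartic_Δ {F : Type*} [Field F] [CharZero F] {q : F} (hq : q ≠ 0)
    (b c d e : F) : (weierstrassOfQuartic q b c d e).Δ =
      16 * (256 * q ^ 6 * e ^ 3 - 192 * q ^ 4 * b * d * e ^ 2 - 128 * q ^ 4 * c ^ 2 * e ^ 2
        + 144 * q ^ 4 * c * d ^ 2 * e - 27 * q ^ 4 * d ^ 4 + 144 * q ^ 2 * b ^ 2 * c * e ^ 2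
        - 6 * q ^ 2 * b ^ 2 * d ^ 2 * e - 80 * q ^ 2 * b * c ^ 2 * d * e
        + 18 * q ^ 2 * b * c * d ^ 3 + 16 * q ^ 2 * c ^ 4 * e - 4 * q ^ 2 * c ^ 3 * d ^ 2
        - 27 * b ^ 4 * e ^ 2 + 18 * b ^ 3 * c * d * e - 4 * b ^ 3 * d ^ 3
        - 4 * b ^ 2 * c ^ 3 * e + b ^ 2 * c ^ 2 * d ^ 2) := by
  simp only [weierstrassOfQuartic, WeierstrassCurve.Δ, WeierstrassCurve.b₂, WeierstrassCurve.b₄,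
    WeierstrassCurve.b₆, WeierstrassCurve.b₈]
  field_simp
  ring

theorem weierstrassOfQuartic_equation {F : Type*} [Field F] [CharZero F] {q : F} (hq : q ≠ 0)
    {b c d e x y : F} (h : y ^ 2 = q ^ 2 * x ^ 4 + b * x ^ 3 + c * x ^ 2 + d * x + e) :
    (weierstrassOfQuartic q b c d e).toAffine.Equation (cubicX q b x y) (cubicY q b c x y) := by
  rw [WeierstrassCurve.Affine.equation_iff]
  simp only [weierstrassOfQuartic, cubicX, cubicY]
  field_simp
  obtain rfl : e = y ^ 2 - (q ^ 2 * x ^ 4 + b * x ^ 3 + c * x ^ 2 + d * x) := by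
    rw [h]; ring
  ring

theorem weierstrassOfQuartic_equation_infMinus {F : Type*} [Field F] (q b c d e : F) :
    (weierstrassOfQuartic q b c d e).toAffine.Equation (-(weierstrassOfQuartic q b c d e).a₂)
      ((weierstrassOfQuartic q b c d e).a₁ * (weierstrassOfQuartic q b c d e).a₂
        - (weierstrassOfQuartic q b c d e).a₃) := by
  rw [WeierstrassCurve.Affine.equation_iff]
  simp only [weierstrassOfQuartic]
  ring

theorem leadRoot_ne_zero {F : Type*} [Field F] [Algebra ℚ F] (t : F) [h : (model t).IsElliptic] :
    leadRoot t ≠ 0 := by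
  intro h0
  have := h.isUnit.ne_zero
  apply this
  simp [model, weierstrassOfQuartic, h0, WeierstrassCurve.Δ, WeierstrassCurve.b₂,
    WeierstrassCurve.b₄, WeierstrassCurve.b₆, WeierstrassCurve.b₈]

/-- The map from the points of the quartic to the points of its Weierstrass model. The point
`infPlus` is the origin of the group law. -/
def toPoint {F : Type*} [Field F] [Algebra ℚ F] {t : F} [(model t).IsElliptic] :
    CurvePoint t → (model t).toAffine.Point
  | .affine x y h => .some (cubicX (leadRoot t) (quarticCoeff t 3) x y)
      (cubicY (leadRoot t) (quarticCoeff t 3) (quarticCoeff t 2) x y)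
      (WeierstrassCurve.Affine.equation_iff_nonsingular.mp <|
        haveI := algebraRat.charZero F
        weierstrassOfQuartic_equation (leadRoot_ne_zero t) ((onCurve_iff t x y).mp h))
  | .infPlus => .zero
  | .infMinus => .some (-(model t).a₂) ((model t).a₁ * (model t).a₂ - (model t).a₃)
      (WeierstrassCurve.Affine.equation_iff_nonsingular.mp <|
        weierstrassOfQuartic_equation_infMinus _ _ _ _ _)

/-! ### The eight points -/

/-- The seven zeros `x_i` of `B² - 4AC`. -/
def roots : Fin 7 → ℚ := ![1, -1, 4, -4, 9, -9, 16]

theorem onCurve_S {F : Type*} [Field F] [Algebra ℚ F] (t : F) : OnCurve t 0 (12 * t) := by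
  rw [onCurve_iff]
  obtain ⟨hA0, -⟩ := coeffs_coefA
  obtain ⟨hB0, -⟩ := coeffs_coefB
  obtain ⟨hC0, -⟩ := coeffs_coefC
  simp only [quarticCoeff, hA0, hB0, hC0, map_zero, map_ofNat]
  ring

/-- The second coordinate `x² (t² + B(x) / (2 x⁴))` of the point `P_x`. -/
def ordinate {F : Type*} [Field F] [Algebra ℚ F] (t x : F) : F :=
  x ^ 2 * (t ^ 2 + aeval x coefB / (2 * x ^ 4))

theorem onCurve_P {F : Type*} [Field F] [Algebra ℚ F] (t : F) (i : Fin 7) :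
    OnCurve t (algebraMap ℚ F (roots i)) (ordinate t (algebraMap ℚ F (roots i))) := by
  have := algebraRat.charZero F
  have h0 : roots i ≠ 0 := by fin_cases i <;> simp [roots]
  have hx : algebraMap ℚ F (roots i) ≠ 0 := by simpa using h0
  have hD : (coefB.eval (roots i)) ^ 2 = 4 * (roots i) ^ 4 * coefC.eval (roots i) := by
    fin_cases i <;> simp [roots, coefB, coefC, -map_div₀, -map_neg] <;> norm_num
  have hD' := congrArg (algebraMap ℚ F) hD
  simp only [map_pow, map_mul, map_ofNat] at hD'
  rw [OnCurve, ordinate, aeval_algebraMap_apply, aeval_algebraMap_apply,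
    aeval_algebraMap_apply]
  simp only [coe_aeval_eq_eval, coefA, eval_X, map_pow]
  field_simp
  linear_combination hD'

/-- The eight points: first `S₀ = (0, 12 t)`, then the seven points `P_x` with `x` a zero of
`B² - 4AC`. -/
def pts {F : Type*} [Field F] [Algebra ℚ F] (t : F) : Fin 8 → CurvePoint t :=
  Fin.cons (.affine 0 (12 * t) (onCurve_S t))
    fun i : Fin 7 => .affine _ _ (onCurve_P t i)

/-! ### Nonsingularity of the generic curve and of the specialization at `T = 1` -/

theorem model_isElliptic {F : Type*} [Field F] [Algebra ℚ F] {t : F}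
    (φ : ℚ[X] →+* F) (hφ : Function.Injective φ) (ht : φ X = t) : (model t).IsElliptic := by
  have := algebraRat.charZero F
  obtain ⟨hA0, hA1, hA2, hA3, hA4⟩ := coeffs_coefA
  obtain ⟨hB0, hB1, hB2, hB3, hB4⟩ := coeffs_coefB
  obtain ⟨hC0, hC1, hC2, hC3, hC4⟩ := coeffs_coefC
  have hC : ∀ a : ℚ, algebraMap ℚ F a = φ (C a) := fun a =>
    (RingHom.congr_fun (Subsingleton.elim (algebraMap ℚ F) (φ.comp C)) a)
  have hq : leadRoot t = φ (X ^ 2 + C (coefB.coeff 4 / 2)) := by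
    simp only [leadRoot, hC, ← ht, map_add, map_pow]
  have hc : ∀ i, quarticCoeff t i
      = φ (C (coefA.coeff i) * X ^ 4 + C (coefB.coeff i) * X ^ 2 + C (coefC.coeff i)) := by
    intro i
    simp only [quarticCoeff, hC, ← ht, map_add, map_pow, map_mul]
  have hq0 : leadRoot t ≠ 0 := by
    rw [hq, Ne, map_eq_zero_iff φ hφ]
    intro h
    have := congrArg (eval 1) h
    simp only [eval_add, eval_pow, eval_X, eval_C, eval_zero, hB4] at this
    norm_num at this
  constructor
  rw [isUnit_iff_ne_zero, model, weierstrassOfQuartic_Δ hq0, hq, hc, hc, hc, hc]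
  simp only [← map_pow, ← map_mul, ← map_sub, ← map_add, ← map_ofNat φ]
  rw [Ne, map_eq_zero_iff φ hφ]
  intro h
  have := congrArg (eval 1) h
  simp only [eval_add, eval_sub, eval_mul, eval_pow, eval_X, eval_C, eval_zero, eval_ofNat,
    hA0, hA1, hA2, hA3, hB0, hB1, hB2, hB3, hB4, hC0, hC1, hC2, hC3] at this
  norm_num at this

instance model_generic_isElliptic : (model (RatFunc.X : RatFunc ℚ)).IsElliptic :=
  model_isElliptic (algebraMap ℚ[X] (RatFunc ℚ)) (RatFunc.algebraMap_injective ℚ)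
    RatFunc.algebraMap_X

instance model_one_isElliptic : (model (1 : ℚ)).IsElliptic := by
  obtain ⟨hA0, hA1, hA2, hA3, hA4⟩ := coeffs_coefA
  obtain ⟨hB0, hB1, hB2, hB3, hB4⟩ := coeffs_coefB
  obtain ⟨hC0, hC1, hC2, hC3, hC4⟩ := coeffs_coefC
  constructor
  rw [isUnit_iff_ne_zero, model, weierstrassOfQuartic_Δ (by rw [leadRoot, hB4]; norm_num)]
  simp only [leadRoot, quarticCoeff, eq_ratCast, Rat.cast_id,
    hA0, hA1, hA2, hA3, hB0, hB1, hB2, hB3, hB4, hC0, hC1, hC2, hC3]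
  norm_num

/-! ### The specialization at `T = 1` -/

/-- The curve `E₁ : y² = x³ - x² - α x + β`. -/
def E₁ : WeierstrassCurve ℚ where
  a₁ := 0
  a₂ := -1
  a₃ := 0
  a₄ := -357917711928106838175050781865
  a₆ := 8790806811671574287759992288018136706011725

/-- The change of variables from the Weierstrass model of the curve at `T = 1` to `E₁`. -/
def changeToE₁ : WeierstrassCurve.VariableChange ℚ where
  u := Units.mk0 (1 / 1327104) (by norm_num)
  r := -305904758142181 / 1761205026816
  s := -460269983048203 / 375154481405952
  t := -5212517942348903529332261455 / 110120659747452044257001472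

theorem changeToE₁_smul : changeToE₁ • model (1 : ℚ) = E₁ := by
  obtain ⟨hA0, hA1, hA2, hA3, hA4⟩ := coeffs_coefA
  obtain ⟨hB0, hB1, hB2, hB3, hB4⟩ := coeffs_coefB
  obtain ⟨hC0, hC1, hC2, hC3, hC4⟩ := coeffs_coefC
  rw [WeierstrassCurve.variableChange_def]
  simp only [model, weierstrassOfQuartic, E₁, changeToE₁, leadRoot, quarticCoeff,
    eq_ratCast, Rat.cast_id, Units.val_inv_eq_inv_val, Units.val_mk0,
    hA0, hA1, hA2, hA3, hB0, hB1, hB2, hB3, hB4, hC0, hC1, hC2, hC3]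
  norm_num

theorem equation_variableChange {F : Type*} [Field F] (W : WeierstrassCurve F)
    (V : WeierstrassCurve.VariableChange F) {x y : F} (h : W.toAffine.Equation x y) :
    (V • W).toAffine.Equation ((x - V.r) / V.u ^ 2)
      ((y - V.s * (x - V.r) - V.t) / V.u ^ 3) := by
  rw [WeierstrassCurve.Affine.equation_iff] at h ⊢
  have hu : (V.u : F) ≠ 0 := V.u.ne_zero
  simp only [WeierstrassCurve.variableChange_def, Units.val_inv_eq_inv_val]
  field_simp
  linear_combination h

/-- The map on points given by an admissible change of variables `V` from `W` to `W' = V • W`,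
which replaces `(x, y)` by `(x', y')` with `x = u² x' + r` and `y = u³ y' + u² s x' + t`. -/
def changePoint {F : Type*} [Field F] {W W' : WeierstrassCurve F} [W.IsElliptic]
    (V : WeierstrassCurve.VariableChange F) (hV : V • W = W') :
    W.toAffine.Point → W'.toAffine.Point
  | .zero => .zero
  | .some x y h => .some ((x - V.r) / V.u ^ 2) ((y - V.s * (x - V.r) - V.t) / V.u ^ 3) (by
      subst hV
      exact WeierstrassCurve.Affine.equation_iff_nonsingular.mp
        (equation_variableChange W V h.1))

/-- The images on `E₁` of the eight points specialized at `T = 1`. -/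
def ptsE₁ (i : Fin 8) : E₁.toAffine.Point :=
  changePoint changeToE₁ changeToE₁_smul (toPoint (pts (1 : ℚ) i))

/-! ### Heights -/

/-- The naive height of a rational point: the logarithmic height of its `x`-coordinate, that is
`log (max |m| n)` if the coordinate is `m / n` in lowest terms, and `0` for the origin. -/
def naiveHeight {W : WeierstrassCurve ℚ} : W.toAffine.Point → ℝ
  | .zero => 0
  | .some x _ _ => Height.logHeight₁ x

/-- `H` is the canonical (Néron–Tate) height `H(P) = lim h(2ⁿ P) / 4ⁿ`, with `h` the naive height
of the `x`-coordinate; in particular all these limits exist. -/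
def IsCanonicalHeight {W : WeierstrassCurve ℚ} (H : W.toAffine.Point → ℝ) : Prop :=
  ∀ P : W.toAffine.Point, Filter.Tendsto
    (fun n : ℕ => naiveHeight ((2 ^ n : ℕ) • P) / 4 ^ n) Filter.atTop (nhds (H P))

/-- The height matrix `⟨P_i, P_j⟩ = (H(P_i + P_j) - H(P_i) - H(P_j)) / 2`, with diagonal entries
`⟨P, P⟩ = H(P)`. -/
def heightMatrix {W : WeierstrassCurve ℚ} (H : W.toAffine.Point → ℝ) {n : ℕ}
    (P : Fin n → W.toAffine.Point) : Matrix (Fin n) (Fin n) ℝ :=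
  Matrix.of fun i j => (H (P i + P j) - H (P i) - H (P j)) / 2

end

end RankEight

namespace RankEight

open Polynomial
open WeierstrassCurve.Affine

noncomputable section

/-! ### Slopes and changes of variables -/

theorem slope_spec {F : Type*} [Field F] [DecidableEq F] {W : WeierstrassCurve.Affine F}
    {x₁ x₂ y₁ y₂ : F} (h₁ : W.Equation x₁ y₁) (h₂ : W.Equation x₂ y₂)
    (h : ¬(x₁ = x₂ ∧ y₁ = W.negY x₂ y₂)) :
    (x₁ - x₂) * W.slope x₁ x₂ y₁ y₂ = y₁ - y₂ ∧
    (y₁ - W.negY x₂ y₂) * W.slope x₁ x₂ y₁ y₂ =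
      x₁ ^ 2 + x₁ * x₂ + x₂ ^ 2 + W.a₂ * (x₁ + x₂) + W.a₄ - W.a₁ * y₁ := by
  by_cases hx : x₁ = x₂
  · have hy : y₁ ≠ W.negY x₂ y₂ := fun hy => h ⟨hx, hy⟩
    have hyy := Y_eq_of_Y_ne h₁ h₂ hx hy
    rw [slope_of_Y_ne hx hy]
    subst hx hyy
    refine ⟨by ring, ?_⟩
    rw [mul_div_cancel₀ _ (sub_ne_zero.mpr hy)]
    ring
  · rw [slope_of_X_ne hx]
    have hx' := sub_ne_zero.mpr hx
    refine ⟨mul_div_cancel₀ _ hx', ?_⟩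
    rw [equation_iff] at h₁ h₂
    rw [mul_div_assoc', div_eq_iff hx', negY]
    linear_combination h₁ - h₂

theorem eq_slope {F : Type*} [Field F] [DecidableEq F] {W : WeierstrassCurve.Affine F}
    {x₁ x₂ y₁ y₂ l : F} (h₁ : W.Equation x₁ y₁) (h₂ : W.Equation x₂ y₂)
    (h : ¬(x₁ = x₂ ∧ y₁ = W.negY x₂ y₂)) (hl : (x₁ - x₂) * l = y₁ - y₂)
    (hl' : (y₁ - W.negY x₂ y₂) * l =
      x₁ ^ 2 + x₁ * x₂ + x₂ ^ 2 + W.a₂ * (x₁ + x₂) + W.a₄ - W.a₁ * y₁) :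
    W.slope x₁ x₂ y₁ y₂ = l := by
  obtain ⟨h3, h4⟩ := slope_spec h₁ h₂ h
  by_cases hx : x₁ = x₂
  · have hy : y₁ - W.negY x₂ y₂ ≠ 0 := sub_ne_zero.mpr fun hy => h ⟨hx, hy⟩
    exact mul_left_cancel₀ hy (h4.trans hl'.symm)
  · exact mul_left_cancel₀ (sub_ne_zero.mpr hx) (h3.trans hl.symm)

theorem changePoint_some {F : Type*} [Field F] {W W' : WeierstrassCurve F} [W.IsElliptic]
    (V : WeierstrassCurve.VariableChange F) (hV : V • W = W') {x y : F}
    (h : W.toAffine.Nonsingular x y) : ∃ h',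
    changePoint V hV (.some x y h) =
      .some ((x - V.r) / V.u ^ 2) ((y - V.s * (x - V.r) - V.t) / V.u ^ 3) h' := ⟨_, rfl⟩

theorem changePoint_add {F : Type*} [Field F] [DecidableEq F] {W W' : WeierstrassCurve F}
    [W.IsElliptic] (V : WeierstrassCurve.VariableChange F) (hV : V • W = W')
    (P Q : W.toAffine.Point) :
    changePoint V hV (P + Q) = changePoint V hV P + changePoint V hV Q := by
  have hu : (V.u : F) ≠ 0 := V.u.ne_zero
  have ha1 : W'.a₁ = (W.a₁ + 2 * V.s) / V.u := by
    rw [← hV]; simp [WeierstrassCurve.variableChange_def]; field_simp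
  have ha2 : W'.a₂ = (W.a₂ - V.s * W.a₁ + 3 * V.r - V.s ^ 2) / V.u ^ 2 := by
    rw [← hV]; simp [WeierstrassCurve.variableChange_def]; field_simp
  have ha3 : W'.a₃ = (W.a₃ + V.r * W.a₁ + 2 * V.t) / V.u ^ 3 := by
    rw [← hV]; simp [WeierstrassCurve.variableChange_def]; field_simp
  have ha4 : W'.a₄ = (W.a₄ - V.s * W.a₃ + 2 * V.r * W.a₂ - (V.t + V.r * V.s) * W.a₁
      + 3 * V.r ^ 2 - 2 * V.s * V.t) / V.u ^ 4 := by
    rw [← hV]; simp [WeierstrassCurve.variableChange_def]; field_simp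
  have hneg : ∀ x y, W'.toAffine.negY ((x - V.r) / V.u ^ 2)
      ((y - V.s * (x - V.r) - V.t) / V.u ^ 3)
      = (W.toAffine.negY x y - V.s * (x - V.r) - V.t) / V.u ^ 3 := by
    intro x y
    simp only [negY, ha1, ha3]
    field_simp
    ring
  match P, Q with
  | .zero, Q => rw [← Point.zero_def, zero_add]; exact (zero_add _).symm
  | P, .zero => rw [← Point.zero_def, add_zero]; exact (add_zero _).symm
  | .some x₁ y₁ h₁, .some x₂ y₂ h₂ =>
    obtain ⟨k₁, e₁⟩ := changePoint_some V hV h₁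
    obtain ⟨k₂, e₂⟩ := changePoint_some V hV h₂
    rw [e₁, e₂]
    by_cases h : x₁ = x₂ ∧ y₁ = W.toAffine.negY x₂ y₂
    · rw [Point.add_of_Y_eq h.1 h.2, Point.add_of_Y_eq (by rw [h.1])]
      · rfl
      · rw [hneg, ← h.2, h.1]
    · have h' : ¬((x₁ - V.r) / V.u ^ 2 = (x₂ - V.r) / V.u ^ 2 ∧
          (y₁ - V.s * (x₁ - V.r) - V.t) / V.u ^ 3 = W'.toAffine.negY ((x₂ - V.r) / V.u ^ 2)
            ((y₂ - V.s * (x₂ - V.r) - V.t) / V.u ^ 3)) := by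
        rw [hneg]
        rintro ⟨h3, h4⟩
        have h5 : x₁ = x₂ := by
          field_simp at h3; linear_combination h3
        refine h ⟨h5, ?_⟩
        rw [h5] at h4
        field_simp at h4
        linear_combination h4
      rw [Point.add_some h, Point.add_some h']
      obtain ⟨k₃, e₃⟩ := changePoint_some V hV (nonsingular_add h₁ h₂ h)
      rw [e₃]
      obtain ⟨s1, s2⟩ := slope_spec h₁.1 h₂.1 h
      set l := W.toAffine.slope x₁ x₂ y₁ y₂
      have hs := eq_slope (l := (l - V.s) / V.u) k₁.1 k₂.1 h'
        (by field_simp; linear_combination s1)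
        (by
          rw [hneg, ha1, ha2, ha4]
          field_simp
          simp only [negY] at s2 ⊢
          linear_combination s2 - V.s * s1)
      simp only [hs, addY, negAddY, addX, negY, ha1, ha2, ha3, Point.some.injEq]
      constructor
      · field_simp; ring
      · field_simp; ring

/-! ### Specialization of points -/

/-- A place of a field `K` with values in a field `k`, given by the relation "`x` is finite with
value `a`". -/
structure Place (K k : Type*) [Field K] [Field k] where
  /-- `val x a` says that `x` is finite at the place, with value `a`. -/
  val : K → k → Prop
  unique : ∀ {x a b}, val x a → val x b → a = b
  one : val 1 1
  add : ∀ {x y a b}, val x a → val y b → val (x + y) (a + b)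
  mul : ∀ {x y a b}, val x a → val y b → val (x * y) (a * b)
  neg : ∀ {x a}, val x a → val (-x) (-a)
  total : ∀ x, (∃ a, val x a) ∨ val x⁻¹ 0

namespace Place

variable {K k : Type*} [Field K] [Field k] (v : Place K k)

theorem zero : v.val 0 0 := by
  simpa using v.add v.one (v.neg v.one)

theorem sub {x y : K} {a b : k} (hx : v.val x a) (hy : v.val y b) : v.val (x - y) (a - b) := by
  simpa only [sub_eq_add_neg] using v.add hx (v.neg hy)

theorem pow {x : K} {a : k} (hx : v.val x a) (n : ℕ) : v.val (x ^ n) (a ^ n) := by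
  induction n with
  | zero => simpa using v.one
  | succ n ih => simpa only [pow_succ] using v.mul ih hx

theorem ne_zero {x : K} {a : k} (hx : v.val x a) (ha : a ≠ 0) : x ≠ 0 := by
  rintro rfl
  exact ha (v.unique hx v.zero)

theorem inv {x : K} {a : k} (hx : v.val x a) (ha : a ≠ 0) : v.val x⁻¹ a⁻¹ := by
  have hx0 := v.ne_zero hx ha
  rcases v.total x⁻¹ with ⟨b, hb⟩ | h
  · have h1 := v.mul hx hb
    rw [mul_inv_cancel₀ hx0] at h1
    rwa [← eq_inv_of_mul_eq_one_right (v.unique h1 v.one)]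
  · rw [inv_inv] at h
    exact absurd (v.unique hx h) ha

theorem div {x y : K} {a b : k} (hx : v.val x a) (hy : v.val y b) (hb : b ≠ 0) :
    v.val (x / y) (a / b) := by
  simpa only [div_eq_mul_inv] using v.mul hx (v.inv hy hb)

/-- The element `x` is finite at the place. -/
def Finite (x : K) : Prop := ∃ a, v.val x a

theorem val_inv_of_not_finite {x : K} (h : ¬ v.Finite x) : v.val x⁻¹ 0 :=
  (v.total x).resolve_left h

theorem ne_zero_of_not_finite {x : K} (h : ¬ v.Finite x) : x ≠ 0 := by
  rintro rfl
  exact h ⟨0, v.zero⟩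

/-- An element whose square is integral of positive valuation over the place is small. -/
theorem val_zero_of_quadratic {w b c : K} (hb : v.val b 0) (hc : v.val c 0)
    (h : w ^ 2 + b * w = c) : v.val w 0 := by
  by_cases hw : v.Finite w
  · obtain ⟨a, ha⟩ := hw
    have h1 := v.add (v.pow ha 2) (v.mul hb ha)
    rw [h] at h1
    have h2 := v.unique h1 hc
    have h3 : a ^ 2 = 0 := by simpa using h2
    rw [pow_eq_zero_iff (by norm_num)] at h3
    rwa [h3] at ha
  · have hw0 := v.ne_zero_of_not_finite hw
    have h1 := v.val_inv_of_not_finite hw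
    have h2 : v.val (1 + b * w⁻¹) (1 + 0 * 0) := v.add v.one (v.mul hb h1)
    have h3 : v.val (c * w⁻¹ * w⁻¹) (0 * 0 * 0) := v.mul (v.mul hc h1) h1
    have h4 : 1 + b * w⁻¹ = c * w⁻¹ * w⁻¹ := by
      rw [← h]; field_simp
    rw [h4] at h2
    simpa using v.unique h2 h3

end Place

section Reduction

variable {K k : Type*} [Field K] [Field k] (v : Place K k)

/-- A Weierstrass curve over `K` reduces to a Weierstrass curve over `k`. -/
structure CurveRed (W : WeierstrassCurve K) (W' : WeierstrassCurve k) : Prop where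
  a₁ : v.val W.a₁ W'.a₁
  a₂ : v.val W.a₂ W'.a₂
  a₃ : v.val W.a₃ W'.a₃
  a₄ : v.val W.a₄ W'.a₄
  a₆ : v.val W.a₆ W'.a₆

/-- A point of a Weierstrass curve over `K` reduces to a point of a Weierstrass curve
over `k`. -/
def PointRed {W : WeierstrassCurve K} {W' : WeierstrassCurve k} :
    W.toAffine.Point → W'.toAffine.Point → Prop
  | .zero, .zero => True
  | .some x _ _, .zero => ¬ v.Finite x
  | .zero, .some _ _ _ => False
  | .some x y _, .some a b _ => v.val x a ∧ v.val y b

variable {v} {W : WeierstrassCurve K} {W' : WeierstrassCurve k}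

theorem CurveRed.val_inv_cube (hW : CurveRed v W W') {x y : K} (h : W.toAffine.Equation x y)
    (hx : ¬ v.Finite x) : v.val (y / x ^ 2) 0 := by
  have hx0 := v.ne_zero_of_not_finite hx
  have hi := v.val_inv_of_not_finite hx
  refine v.val_zero_of_quadratic (b := W.a₁ * x⁻¹ + W.a₃ * x⁻¹ ^ 2)
    (c := x⁻¹ + W.a₂ * x⁻¹ ^ 2 + W.a₄ * x⁻¹ ^ 3 + W.a₆ * x⁻¹ ^ 4) ?_ ?_ ?_
  · simpa using v.add (v.mul hW.a₁ hi) (v.mul hW.a₃ (v.pow hi 2))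
  · simpa using v.add (v.add (v.add hi (v.mul hW.a₂ (v.pow hi 2))) (v.mul hW.a₄ (v.pow hi 3)))
      (v.mul hW.a₆ (v.pow hi 4))
  · rw [WeierstrassCurve.Affine.equation_iff] at h
    field_simp
    linear_combination h

theorem CurveRed.finite_y (hW : CurveRed v W W') {x y : K} (h : W.toAffine.Equation x y)
    (hx : v.Finite x) : v.Finite y := by
  obtain ⟨a, ha⟩ := hx
  by_contra hy
  have hy0 := v.ne_zero_of_not_finite hy
  have hi := v.val_inv_of_not_finite hy
  rw [WeierstrassCurve.Affine.equation_iff] at h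
  have h1 : (1 : K) = (x ^ 3 + W.a₂ * x ^ 2 + W.a₄ * x + W.a₆) * y⁻¹ ^ 2 - (W.a₁ * x + W.a₃) * y⁻¹ := by
    field_simp
    linear_combination h
  have h2 := v.sub (v.mul (v.add (v.add (v.add (v.pow ha 3) (v.mul hW.a₂ (v.pow ha 2)))
    (v.mul hW.a₄ ha)) hW.a₆) (v.pow hi 2)) (v.mul (v.add (v.mul hW.a₁ ha) hW.a₃) hi)
  rw [← h1] at h2
  simpa using v.unique v.one h2

theorem CurveRed.equation (hW : CurveRed v W W') {x y : K} {a b : k} (hx : v.val x a)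
    (hy : v.val y b) (h : W.toAffine.Equation x y) : W'.toAffine.Equation a b := by
  rw [WeierstrassCurve.Affine.equation_iff] at h ⊢
  have h1 := v.add (v.add (v.pow hy 2) (v.mul (v.mul hW.a₁ hx) hy)) (v.mul hW.a₃ hy)
  have h2 := v.add (v.add (v.add (v.pow hx 3) (v.mul hW.a₂ (v.pow hx 2)))
    (v.mul hW.a₄ hx)) hW.a₆
  rw [h] at h1
  exact v.unique h1 h2

theorem CurveRed.negY (hW : CurveRed v W W') {x y : K} {a b : k} (hx : v.val x a)
    (hy : v.val y b) : v.val (W.toAffine.negY x y) (W'.toAffine.negY a b) :=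
  v.sub (v.sub (v.neg hy) (v.mul hW.a₁ hx)) hW.a₃

theorem CurveRed.neg (hW : CurveRed v W W') {P : W.toAffine.Point} {P' : W'.toAffine.Point}
    (h : PointRed v P P') : PointRed v (-P) (-P') := by
  match P, P', h with
  | .zero, .zero, _ => exact trivial
  | .some x y _, .zero, h => exact h
  | .some x y _, .some a b _, h => exact ⟨h.1, hW.negY h.1 h.2⟩

theorem PointRed.unique {P : W.toAffine.Point} {P' Q' : W'.toAffine.Point}
    (h : PointRed v P P') (h' : PointRed v P Q') : P' = Q' := by
  match P, P', Q', h, h' with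
  | .zero, .zero, .zero, _, _ => rfl
  | .some x y _, .zero, .zero, _, _ => rfl
  | .some x y _, .zero, .some a b _, h, h' => exact absurd ⟨_, h'.1⟩ h
  | .some x y _, .some a b _, .zero, h, h' => exact absurd ⟨_, h.1⟩ h'
  | .some x y _, .some a b _, .some a' b' _, h, h' =>
    obtain rfl := v.unique h.1 h'.1
    obtain rfl := v.unique h.2 h'.2
    rfl

theorem CurveRed.add_of_val_slope (hW : CurveRed v W W') {x₁ x₂ y₁ : K} {a₁ a₂ b₁ : k} (hx₁ : v.val x₁ a₁) (hx₂ : v.val x₂ a₂) (hy₁ : v.val y₁ b₁) {l : K} {m : k}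
    (hl : v.val l m) :
    v.val (W.toAffine.addX x₁ x₂ l) (W'.toAffine.addX a₁ a₂ m) ∧
    v.val (W.toAffine.addY x₁ x₂ y₁ l) (W'.toAffine.addY a₁ a₂ b₁ m) := by
  have h1 : v.val (W.toAffine.addX x₁ x₂ l) (W'.toAffine.addX a₁ a₂ m) :=
    v.sub (v.sub (v.sub (v.add (v.pow hl 2) (v.mul hW.a₁ hl)) hW.a₂) hx₁) hx₂
  exact ⟨h1, hW.negY h1 (v.add (v.mul hl (v.sub h1 hx₁)) hy₁)⟩

variable [DecidableEq K] [DecidableEq k]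

theorem CurveRed.add_finite [W'.IsElliptic] (hW : CurveRed v W W') {x₁ x₂ y₁ y₂ : K}
    {a₁ a₂ b₁ b₂ : k}
    (h₁ : W.toAffine.Nonsingular x₁ y₁) (h₂ : W.toAffine.Nonsingular x₂ y₂)
    (k₁ : W'.toAffine.Nonsingular a₁ b₁) (k₂ : W'.toAffine.Nonsingular a₂ b₂)
    (hx₁ : v.val x₁ a₁) (hx₂ : v.val x₂ a₂) (hy₁ : v.val y₁ b₁) (hy₂ : v.val y₂ b₂) :
    PointRed v (.some x₁ y₁ h₁ + .some x₂ y₂ h₂ : W.toAffine.Point)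
      (.some a₁ b₁ k₁ + .some a₂ b₂ k₂ : W'.toAffine.Point) := by
  by_cases hk : a₁ = a₂ ∧ b₁ = W'.toAffine.negY a₂ b₂
  · rw [Point.add_of_Y_eq hk.1 hk.2]
    by_cases h : x₁ = x₂ ∧ y₁ = W.toAffine.negY x₂ y₂
    · rw [Point.add_of_Y_eq h.1 h.2]; exact trivial
    rw [Point.add_some h]
    obtain ⟨s1, s2⟩ := slope_spec h₁.1 h₂.1 h
    set l := W.toAffine.slope x₁ x₂ y₁ y₂ with hl
    change ¬ v.Finite (W.toAffine.addX x₁ x₂ l)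
    by_cases hfl : v.Finite l
    · exfalso
      obtain ⟨m, hm⟩ := hfl
      have e1 := v.mul (v.sub hx₁ hx₂) hm
      rw [s1] at e1
      have e2 := v.unique e1 (v.sub hy₁ hy₂)
      have e3 := v.mul (v.sub hy₁ (hW.negY hx₂ hy₂)) hm
      rw [s2] at e3
      have e4 := v.unique e3 (v.sub (v.add (v.add (v.add (v.add (v.pow hx₁ 2) (v.mul hx₁ hx₂))
        (v.pow hx₂ 2)) (v.mul hW.a₂ (v.add hx₁ hx₂))) hW.a₄) (v.mul hW.a₁ hy₁))
      obtain ⟨hk1, hk2⟩ := hk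
      subst hk1
      have hb : b₁ = b₂ := by linear_combination -e2
      subst hb
      rw [← hk2] at e4
      have hns := (WeierstrassCurve.Affine.nonsingular_iff' _ _).mp k₁
      simp only [WeierstrassCurve.Affine.negY] at hk2
      rcases hns.2 with h3 | h3
      · exact h3 (by linear_combination e4)
      · exact h3 (by linear_combination hk2)
    · intro hX
      obtain ⟨X, hX⟩ := hX
      have hl0 := v.ne_zero_of_not_finite hfl
      have hi := v.val_inv_of_not_finite hfl
      have e1 : (1 : K) = (W.toAffine.addX x₁ x₂ l + W.a₂ + x₁ + x₂) * l⁻¹ ^ 2 - W.a₁ * l⁻¹ := by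
        simp only [WeierstrassCurve.Affine.addX]
        field_simp
        ring
      have e2 := v.sub (v.mul (v.add (v.add (v.add hX hW.a₂) hx₁) hx₂) (v.pow hi 2))
        (v.mul hW.a₁ hi)
      rw [← e1] at e2
      simpa using v.unique v.one e2
  · have h : ¬(x₁ = x₂ ∧ y₁ = W.toAffine.negY x₂ y₂) := by
      rintro ⟨rfl, h⟩
      obtain rfl := v.unique hx₁ hx₂
      rw [h] at hy₁
      exact hk ⟨rfl, v.unique hy₁ (hW.negY hx₂ hy₂)⟩
    rw [Point.add_some h, Point.add_some hk]
    obtain ⟨s1, s2⟩ := slope_spec h₁.1 h₂.1 h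
    obtain ⟨t1, t2⟩ := slope_spec k₁.1 k₂.1 hk
    have hl : v.val (W.toAffine.slope x₁ x₂ y₁ y₂) (W'.toAffine.slope a₁ a₂ b₁ b₂) := by
      by_cases ha : a₁ = a₂
      · have hb : b₁ - W'.toAffine.negY a₂ b₂ ≠ 0 := sub_ne_zero.mpr fun hb => hk ⟨ha, hb⟩
        have e := v.sub hy₁ (hW.negY hx₂ hy₂)
        rw [mul_comm] at s2 t2
        rw [eq_div_of_mul_eq (v.ne_zero e hb) s2, eq_div_of_mul_eq hb t2]
        exact v.div (v.sub (v.add (v.add (v.add (v.add (v.pow hx₁ 2) (v.mul hx₁ hx₂))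
          (v.pow hx₂ 2)) (v.mul hW.a₂ (v.add hx₁ hx₂))) hW.a₄) (v.mul hW.a₁ hy₁)) e hb
      · have ha' := sub_ne_zero.mpr ha
        have e := v.sub hx₁ hx₂
        rw [mul_comm] at s1 t1
        rw [eq_div_of_mul_eq (v.ne_zero e ha') s1, eq_div_of_mul_eq ha' t1]
        exact v.div (v.sub hy₁ hy₂) e ha'
    exact hW.add_of_val_slope hx₁ hx₂ hy₁ hl

omit [DecidableEq k] in
/-- The sum of an infinite and a finite point is finite. -/
theorem CurveRed.finite_add (hW : CurveRed v W W') {x₁ x₂ y₁ y₂ : K}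
    (h₁ : W.toAffine.Nonsingular x₁ y₁) (h₂ : W.toAffine.Nonsingular x₂ y₂)
    (hx₁ : ¬ v.Finite x₁) (hx₂ : v.Finite x₂) : ∃ x y h,
    (.some x₁ y₁ h₁ + .some x₂ y₂ h₂ : W.toAffine.Point) = .some x y h ∧ v.Finite x := by
  obtain ⟨b, hb⟩ := hW.finite_y h₂.1 hx₂
  have hne : x₁ ≠ x₂ := fun h => hx₁ (h ▸ hx₂)
  obtain ⟨a, ha⟩ := hx₂
  refine ⟨_, _, _, Point.add_of_X_ne hne, ?_⟩
  have h0 := v.ne_zero_of_not_finite hx₁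
  have hi := v.val_inv_of_not_finite hx₁
  have hw := hW.val_inv_cube h₁.1 hx₁
  have hs := v.pow (v.sub v.one (v.mul ha hi)) 2
  simp only [mul_zero, sub_zero, one_pow] at hs
  have key : W.toAffine.addX x₁ x₂ (W.toAffine.slope x₁ x₂ y₁ y₂) * (1 - x₂ * x₁⁻¹) ^ 2 =
      x₂ + (x₂ ^ 2 + 2 * W.a₂ * x₂ + W.a₁ ^ 2 * x₂ + W.a₁ * W.a₃ - W.a₁ * y₂ + W.a₄) * x₁⁻¹
      + (W.a₄ * x₂ + 2 * W.a₆ - W.a₃ * y₂) * x₁⁻¹ ^ 2 - (2 * y₂ + W.a₁ * x₂ + W.a₃) * (y₁ / x₁ ^ 2)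
      - (W.a₁ ^ 2 * x₂ + W.a₁ * W.a₃) * x₁⁻¹ := by
    rw [slope_of_X_ne hne]
    have e1 := (WeierstrassCurve.Affine.equation_iff _ _).mp h₁.1
    have e2 := (WeierstrassCurve.Affine.equation_iff _ _).mp h₂.1
    have hne' := sub_ne_zero.mpr hne
    simp only [WeierstrassCurve.Affine.addX]
    field_simp
    linear_combination e1 + e2
  have hr := v.sub (v.sub (v.add (v.add ha (v.mul (v.add (v.sub (v.add (v.add (v.add (v.pow ha 2)
    (v.mul (v.mul (v.add v.one v.one) hW.a₂) ha)) (v.mul (v.pow hW.a₁ 2) ha))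
    (v.mul hW.a₁ hW.a₃)) (v.mul hW.a₁ hb)) hW.a₄) hi)) (v.mul (v.sub (v.add (v.mul hW.a₄ ha)
    (v.mul (v.add v.one v.one) hW.a₆)) (v.mul hW.a₃ hb)) (v.pow hi 2)))
    (v.mul (v.add (v.add (v.mul (v.add v.one v.one) hb) (v.mul hW.a₁ ha)) hW.a₃) hw))
    (v.mul (v.add (v.mul (v.pow hW.a₁ 2) ha) (v.mul hW.a₁ hW.a₃)) hi)
  rw [one_add_one_eq_two, ← key] at hr
  have := v.div hr hs one_ne_zero
  rw [mul_div_cancel_right₀ _ (v.ne_zero hs one_ne_zero)] at this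
  exact ⟨_, this⟩

/-- The reduction of points is additive. -/
theorem CurveRed.add [W'.IsElliptic] (hW : CurveRed v W W') {P Q : W.toAffine.Point}
    {P' Q' : W'.toAffine.Point} (hP : PointRed v P P') (hQ : PointRed v Q Q') :
    PointRed v (P + Q) (P' + Q') := by
  have mixed : ∀ {x₁ x₂ y₁ y₂ : K} {a₂ b₂ : k} (h₁ : W.toAffine.Nonsingular x₁ y₁)
      (h₂ : W.toAffine.Nonsingular x₂ y₂) (k₂ : W'.toAffine.Nonsingular a₂ b₂),
      ¬ v.Finite x₁ → v.val x₂ a₂ → v.val y₂ b₂ →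
      PointRed v (.some x₁ y₁ h₁ + .some x₂ y₂ h₂ : W.toAffine.Point)
        (.some a₂ b₂ k₂ : W'.toAffine.Point) := by
    intro x₁ x₂ y₁ y₂ a₂ b₂ h₁ h₂ k₂ hx₁ hx₂ hy₂
    obtain ⟨x, y, h, e, a, ha⟩ := hW.finite_add h₁ h₂ hx₁ ⟨_, hx₂⟩
    obtain ⟨b, hb⟩ := hW.finite_y h.1 ⟨a, ha⟩
    have k := WeierstrassCurve.Affine.equation_iff_nonsingular.mp (hW.equation ha hb h.1)
    have hneg : PointRed v (-.some x₂ y₂ h₂ : W.toAffine.Point)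
      (-.some a₂ b₂ k₂ : W'.toAffine.Point) := hW.neg ⟨hx₂, hy₂⟩
    have h3 : PointRed v (.some x y h + -.some x₂ y₂ h₂ : W.toAffine.Point)
        (.some a b k + -.some a₂ b₂ k₂ : W'.toAffine.Point) :=
      hW.add_finite _ _ _ _ ha hneg.1 hb hneg.2
    rw [← e, add_neg_cancel_right] at h3
    have h4 := PointRed.unique h3 (show PointRed v _ (.zero : W'.toAffine.Point) from hx₁)
    rw [← Point.zero_def, add_neg_eq_zero] at h4
    rw [e, ← h4]
    exact ⟨ha, hb⟩
  rcases P with _ | ⟨x₁, y₁, h₁⟩ <;> rcases P' with _ | ⟨a₁, b₁, k₁⟩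
  · rw [← Point.zero_def, ← Point.zero_def, zero_add, zero_add]
    exact hQ
  · exact hP.elim
  · rcases Q with _ | ⟨x₂, y₂, h₂⟩ <;> rcases Q' with _ | ⟨a₂, b₂, k₂⟩
    · rw [← Point.zero_def, ← Point.zero_def, add_zero, add_zero]
      exact hP
    · exact hQ.elim
    · rw [← Point.zero_def, add_zero]
      generalize hS : (.some x₁ y₁ h₁ + .some x₂ y₂ h₂ : W.toAffine.Point) = S
      rcases S with _ | ⟨x, y, h⟩
      · exact trivial
      · rintro ⟨a, ha⟩
        obtain ⟨x', y', h', e, hf⟩ :=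
          hW.finite_add ((nonsingular_neg _ _).mpr h₁) h hP ⟨a, ha⟩
        change -(.some x₁ y₁ h₁ : W.toAffine.Point) + .some x y h = _ at e
        rw [← hS, neg_add_cancel_left, Point.some.injEq] at e
        exact hQ (e.1 ▸ hf)
    · rw [← Point.zero_def, zero_add]
      exact mixed h₁ h₂ k₂ hP hQ.1 hQ.2
  · rcases Q with _ | ⟨x₂, y₂, h₂⟩ <;> rcases Q' with _ | ⟨a₂, b₂, k₂⟩
    · rw [← Point.zero_def, ← Point.zero_def, add_zero, add_zero]
      exact hP
    · exact hQ.elim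
    · rw [← Point.zero_def, add_zero, add_comm]
      exact mixed h₂ h₁ k₁ hQ hP.1 hP.2
    · exact hW.add_finite h₁ h₂ k₁ k₂ hP.1 hQ.1 hP.2 hQ.2

/-- A relation among points specializes. -/
theorem CurveRed.sum_zsmul [W'.IsElliptic] (hW : CurveRed v W W') {ι : Type*} (s : Finset ι)
    (n : ι → ℤ) {P : ι → W.toAffine.Point} {P' : ι → W'.toAffine.Point}
    (h : ∀ i, PointRed v (P i) (P' i)) :
    PointRed v (∑ i ∈ s, n i • P i) (∑ i ∈ s, n i • P' i) := by
  have h0 : PointRed v (0 : W.toAffine.Point) (0 : W'.toAffine.Point) := trivial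
  have hn : ∀ i (m : ℕ), PointRed v (m • P i) (m • P' i) := by
    intro i m
    induction m with
    | zero => simpa using h0
    | succ m ih => rw [add_smul, add_smul, one_smul, one_smul]; exact hW.add ih (h i)
  have hz : ∀ i (m : ℤ), PointRed v (m • P i) (m • P' i) := by
    intro i m
    obtain ⟨m, rfl | rfl⟩ := m.eq_nat_or_neg
    · simpa using hn i m
    · simpa using hW.neg (hn i m)
  classical
  induction s using Finset.induction_on with
  | empty => simpa using h0
  | insert i s hi ih => rw [Finset.sum_insert hi, Finset.sum_insert hi]; exact hW.add (hz i _) ih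

end Reduction

/-! ### Specialization at `T = 1` -/

/-- The place of `k(T)` at `T = c`. -/
def placeAt {k : Type*} [Field k] (c : k) : Place (RatFunc k) k where
  val f a := ∃ p q : k[X], q.eval c ≠ 0 ∧ f * algebraMap k[X] (RatFunc k) q
    = algebraMap k[X] (RatFunc k) p ∧ a * q.eval c = p.eval c
  unique := by
    rintro f a b ⟨p, q, hq, hf, ha⟩ ⟨p', q', hq', hf', hb⟩
    have h : p * q' = p' * q := by
      apply RatFunc.algebraMap_injective k
      rw [map_mul, map_mul, ← hf, ← hf']
      ring
    have h' := congrArg (eval c) h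
    rw [eval_mul, eval_mul, ← ha, ← hb] at h'
    exact mul_right_cancel₀ (mul_ne_zero hq hq') (by linear_combination h')
  one := ⟨1, 1, by simp⟩
  add := by
    rintro f g a b ⟨p, q, hq, hf, ha⟩ ⟨p', q', hq', hf', hb⟩
    refine ⟨p * q' + p' * q, q * q', by simp [hq, hq'], ?_, ?_⟩
    · simp only [map_add, map_mul, ← hf, ← hf']; ring
    · simp only [eval_add, eval_mul, ← ha, ← hb]; ring
  mul := by
    rintro f g a b ⟨p, q, hq, hf, ha⟩ ⟨p', q', hq', hf', hb⟩
    refine ⟨p * p', q * q', by simp [hq, hq'], ?_, ?_⟩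
    · simp only [map_mul, ← hf, ← hf']; ring
    · simp only [eval_mul, ← ha, ← hb]; ring
  neg := by
    rintro f a ⟨p, q, hq, hf, ha⟩
    exact ⟨-p, q, hq, by rw [map_neg, ← hf]; ring, by rw [eval_neg, ← ha]; ring⟩
  total f := by
    have hd : algebraMap k[X] (RatFunc k) f.denom ≠ 0 :=
      (map_ne_zero_iff _ (RatFunc.algebraMap_injective k)).mpr f.denom_ne_zero
    have hf : f * algebraMap k[X] (RatFunc k) f.denom = algebraMap k[X] (RatFunc k) f.num := by
      conv_lhs => rw [← RatFunc.num_div_denom f]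
      field_simp
      simp
    by_cases h : f.denom.eval c = 0
    · right
      have hn : f.num.eval c ≠ 0 := by
        obtain ⟨a, b, hab⟩ := RatFunc.isCoprime_num_denom f
        intro hn
        have := congrArg (eval c) hab
        simp [hn, h] at this
      refine ⟨f.denom, f.num, hn, ?_, by rw [h, zero_mul]⟩
      have hf0 : f ≠ 0 := by
        rintro rfl
        simp at hn
      rw [← hf, inv_mul_cancel_left₀ hf0]
    · left
      exact ⟨_, f.num, f.denom, h, hf, div_mul_cancel₀ _ h⟩

theorem placeAt_algebraMap (c a : ℚ) : (placeAt c).val (algebraMap ℚ (RatFunc ℚ) a) a :=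
  ⟨C a, 1, by simp, by simp, by simp⟩

theorem placeAt_X (c : ℚ) : (placeAt c).val RatFunc.X c :=
  ⟨X, 1, by simp, by simp, by simp⟩

theorem placeAt_quarticCoeff (c : ℚ) (i : ℕ) :
    (placeAt c).val (quarticCoeff (RatFunc.X : RatFunc ℚ) i) (quarticCoeff c i) := by
  have v := placeAt c
  have hX := placeAt_X c
  have hC := placeAt_algebraMap c
  exact (placeAt c).add ((placeAt c).add ((placeAt c).mul (hC _) ((placeAt c).pow hX 4))
    ((placeAt c).mul (hC _) ((placeAt c).pow hX 2))) (hC _)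

theorem placeAt_leadRoot (c : ℚ) :
    (placeAt c).val (leadRoot (RatFunc.X : RatFunc ℚ)) (leadRoot c) :=
  (placeAt c).add ((placeAt c).pow (placeAt_X c) 2) (placeAt_algebraMap c _)

theorem placeAt_ofNat (c : ℚ) (n : ℕ) [n.AtLeastTwo] :
    (placeAt c).val (OfNat.ofNat n : RatFunc ℚ) (OfNat.ofNat n : ℚ) := by
  simpa using placeAt_algebraMap c (OfNat.ofNat n)

theorem model_red (c : ℚ) [(model c).IsElliptic] :
    CurveRed (placeAt c) (model (RatFunc.X : RatFunc ℚ)) (model c) := by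
  have hq := placeAt_leadRoot c
  have hq0 := leadRoot_ne_zero c
  have hc := placeAt_quarticCoeff c
  have h2 := (placeAt c).sub (hc 2) ((placeAt c).div ((placeAt c).pow (hc 3) 2)
    ((placeAt c).mul (placeAt_ofNat c 4) ((placeAt c).pow hq 2)) (by simp [hq0]))
  have h4 := (placeAt c).mul ((placeAt c).mul ((placeAt c).neg (placeAt_ofNat c 4))
    ((placeAt c).pow hq 2)) (hc 0)
  exact ⟨(placeAt c).div (hc 3) hq hq0, h2,
    (placeAt c).mul ((placeAt c).mul (placeAt_ofNat c 2) hq) (hc 1), h4, (placeAt c).mul h2 h4⟩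

theorem toPoint_red (c : ℚ) [(model c).IsElliptic] {x y : RatFunc ℚ} {a b : ℚ}
    (h : OnCurve RatFunc.X x y) (k : OnCurve c a b) (hx : (placeAt c).val x a)
    (hy : (placeAt c).val y b) :
    PointRed (placeAt c) (toPoint (.affine x y h)) (toPoint (.affine a b k)) := by
  have hq := placeAt_leadRoot c
  have hq0 := leadRoot_ne_zero c
  have hc := placeAt_quarticCoeff c
  have h2 := placeAt_ofNat c 2
  have h4 := placeAt_ofNat c 4
  have hs := (placeAt c).add hy ((placeAt c).mul hq ((placeAt c).pow hx 2))
  exact ⟨(placeAt c).add ((placeAt c).mul ((placeAt c).mul h2 hq) hs)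
    ((placeAt c).mul (hc 3) hx),
    (placeAt c).sub ((placeAt c).add ((placeAt c).mul ((placeAt c).mul ((placeAt c).mul h4
      ((placeAt c).pow hq 2)) hs) hx) ((placeAt c).mul ((placeAt c).mul h2 hq)
      ((placeAt c).add ((placeAt c).mul (hc 3) ((placeAt c).pow hx 2)) ((placeAt c).mul (hc 2) hx))))
      ((placeAt c).div ((placeAt c).mul ((placeAt c).pow (hc 3) 2) hx) ((placeAt c).mul h2 hq)
      (by simp [hq0]))⟩

theorem pts_red (i : Fin 8) : PointRed (placeAt (1 : ℚ))
    (toPoint (pts (RatFunc.X : RatFunc ℚ) i)) (toPoint (pts (1 : ℚ) i)) := by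
  refine Fin.cases ?_ (fun i => ?_) i
  · refine toPoint_red 1 _ _ (placeAt 1).zero ?_
    exact (placeAt 1).mul (placeAt_ofNat 1 12) (placeAt_X 1)
  · have hr : (placeAt 1).val (algebraMap ℚ (RatFunc ℚ) (roots i)) (algebraMap ℚ ℚ (roots i)) :=
      placeAt_algebraMap 1 _
    have h0 : roots i ≠ 0 := by fin_cases i <;> simp [roots]
    refine toPoint_red 1 _ _ hr ?_
    refine (placeAt 1).mul ((placeAt 1).pow hr 2) ((placeAt 1).add
      ((placeAt 1).pow (placeAt_X 1) 2) ((placeAt 1).div ?_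
      ((placeAt 1).mul (placeAt_ofNat 1 2) ((placeAt 1).pow hr 4)) (by simp [h0])))
    rw [aeval_algebraMap_apply, aeval_algebraMap_apply]
    exact placeAt_algebraMap 1 _

theorem changePoint_sum_zsmul {F : Type*} [Field F] [DecidableEq F] {W W' : WeierstrassCurve F}
    [W.IsElliptic] (V : WeierstrassCurve.VariableChange F) (hV : V • W = W') {ι : Type*}
    (s : Finset ι) (n : ι → ℤ) (P : ι → W.toAffine.Point) :
    changePoint V hV (∑ i ∈ s, n i • P i) = ∑ i ∈ s, n i • changePoint V hV (P i) := by
  let f : W.toAffine.Point →+ W'.toAffine.Point :=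
    AddMonoidHom.mk' (changePoint V hV) (changePoint_add V hV)
  change f _ = ∑ i ∈ s, n i • f (P i)
  simp

theorem linearIndependent_generic [DecidableEq (RatFunc ℚ)] (h : LinearIndependent ℤ ptsE₁) :
    LinearIndependent ℤ (fun i : Fin 8 => toPoint (pts (RatFunc.X : RatFunc ℚ) i)) := by
  rw [Fintype.linearIndependent_iff] at h ⊢
  intro n hn
  apply h n
  have h1 := (model_red 1).sum_zsmul Finset.univ n pts_red
  rw [hn] at h1
  have h2 := PointRed.unique h1 (show PointRed (placeAt (1 : ℚ)) _ 0 from trivial)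
  have h3 := changePoint_sum_zsmul changeToE₁ changeToE₁_smul Finset.univ n
    (fun i => toPoint (pts (1 : ℚ) i))
  rw [h2] at h3
  exact h3.symm

/-! ### The quartic and its Weierstrass model -/

theorem cubicY_eq {F : Type*} [Field F] [CharZero F] {q : F} (hq : q ≠ 0) (b c d e x y : F) :
    cubicY q b c x y
      = 2 * q * x * (cubicX q b x y + (weierstrassOfQuartic q b c d e).a₂) := by
  simp only [cubicX, cubicY, weierstrassOfQuartic]
  field_simp
  ring

/-- The linear equation for the first coordinate of the points of the quartic whose images have
first coordinate `-a₂`. -/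
theorem linear_of_cubicX_eq {F : Type*} [Field F] [CharZero F] {q : F} (hq : q ≠ 0)
    {b c d e x y : F} (h : y ^ 2 = q ^ 2 * x ^ 4 + b * x ^ 3 + c * x ^ 2 + d * x + e)
    (hX : cubicX q b x y = -(weierstrassOfQuartic q b c d e).a₂) :
    2 * q * ((weierstrassOfQuartic q b c d e).a₃ - (weierstrassOfQuartic q b c d e).a₁
      * (weierstrassOfQuartic q b c d e).a₂) * x
      = (weierstrassOfQuartic q b c d e).a₂ ^ 2 + (weierstrassOfQuartic q b c d e).a₄ := by
  obtain rfl : e = y ^ 2 - (q ^ 2 * x ^ 4 + b * x ^ 3 + c * x ^ 2 + d * x) := by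
    rw [h]; ring
  simp only [cubicX, weierstrassOfQuartic] at hX ⊢
  have hy : y = (-(c - b ^ 2 / (4 * q ^ 2)) - b * x) / (2 * q) - q * x ^ 2 := by
    field_simp at hX ⊢
    linear_combination hX
  rw [hy]
  field_simp
  ring

theorem a₃_ne_of_nonsingular {F : Type*} [Field F] [CharZero F] {q : F} (hq : q ≠ 0)
    {b c d e x y : F} (h : y ^ 2 = q ^ 2 * x ^ 4 + b * x ^ 3 + c * x ^ 2 + d * x + e)
    (hX : cubicX q b x y = -(weierstrassOfQuartic q b c d e).a₂)
    (hW : (weierstrassOfQuartic q b c d e).Δ ≠ 0) :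
    (weierstrassOfQuartic q b c d e).a₃ - (weierstrassOfQuartic q b c d e).a₁
      * (weierstrassOfQuartic q b c d e).a₂ ≠ 0 := by
  intro h0
  have h1 := linear_of_cubicX_eq hq h hX
  rw [h0, mul_zero, zero_mul] at h1
  apply hW
  have h6 : (weierstrassOfQuartic q b c d e).a₆ = (weierstrassOfQuartic q b c d e).a₂
      * (weierstrassOfQuartic q b c d e).a₄ := rfl
  generalize weierstrassOfQuartic q b c d e = W at *
  have h3 : W.a₃ = W.a₁ * W.a₂ := by linear_combination h0
  have h4 : W.a₄ = -W.a₂ ^ 2 := by linear_combination -h1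
  simp only [WeierstrassCurve.Δ, WeierstrassCurve.b₂, WeierstrassCurve.b₄,
    WeierstrassCurve.b₆, WeierstrassCurve.b₈, h6, h3, h4]
  ring

theorem toPoint_bijective {F : Type*} [Field F] [Algebra ℚ F] (t : F) [hE : (model t).IsElliptic] :
    Function.Bijective (toPoint (t := t)) := by
  have := algebraRat.charZero F
  have hq := leadRoot_ne_zero t
  have hΔ : (model t).Δ ≠ 0 := hE.isUnit.ne_zero
  have hY : ∀ x y, cubicY (leadRoot t) (quarticCoeff t 3) (quarticCoeff t 2) x y = 2 * leadRoot t
      * x * (cubicX (leadRoot t) (quarticCoeff t 3) x y + (model t).a₂) :=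
    fun x y => cubicY_eq hq _ _ _ _ _ _
  have hinf : ∀ {x y}, OnCurve t x y →
      cubicX (leadRoot t) (quarticCoeff t 3) x y = -(model t).a₂ →
      (model t).a₃ - (model t).a₁ * (model t).a₂ ≠ 0 ∧
      2 * leadRoot t * ((model t).a₃ - (model t).a₁ * (model t).a₂) * x
        = (model t).a₂ ^ 2 + (model t).a₄ := fun h hX =>
    ⟨a₃_ne_of_nonsingular hq ((onCurve_iff t _ _).mp h) hX hΔ,
      linear_of_cubicX_eq hq ((onCurve_iff t _ _).mp h) hX⟩
  have hne : ∀ {x y} (h : OnCurve t x y), toPoint (.affine x y h) ≠ toPoint (.infMinus (t := t)) := by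
    intro x y h e
    simp only [toPoint, Point.some.injEq] at e
    obtain ⟨h1, h2⟩ := hinf h e.1
    have e2 := e.2
    rw [hY, e.1] at e2
    exact h1 (by linear_combination e2)
  constructor
  · intro P Q e
    rcases P with ⟨x, y, h⟩ | _ | _ <;> rcases Q with ⟨x', y', h'⟩ | _ | _
    · simp only [toPoint, Point.some.injEq] at e
      obtain ⟨e1, e2⟩ := e
      have hx : x = x' := by
        by_cases hX : cubicX (leadRoot t) (quarticCoeff t 3) x y = -(model t).a₂
        · obtain ⟨h1, h2⟩ := hinf h hX
          obtain ⟨-, h3⟩ := hinf h' (e1 ▸ hX)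
          exact mul_left_cancel₀ (mul_ne_zero (mul_ne_zero two_ne_zero hq) h1) (h2.trans h3.symm)
        · rw [hY, hY, ← e1] at e2
          have h1 := mul_right_cancel₀ (fun h0 => hX (by linear_combination h0)) e2
          exact mul_left_cancel₀ (mul_ne_zero two_ne_zero hq) h1
      subst hx
      have hy : y = y' := by
        simp only [cubicX] at e1
        exact mul_left_cancel₀ (mul_ne_zero two_ne_zero hq) (by linear_combination e1)
      subst hy
      rfl
    · simp [toPoint] at e
    · exact absurd e (hne h)
    · simp [toPoint] at e
    · rfl
    · simp [toPoint] at e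
    · exact absurd e.symm (hne h')
    · simp [toPoint] at e
    · rfl
  · intro P
    rcases P with _ | ⟨X, Y, h⟩
    · exact ⟨.infPlus, rfl⟩
    have heq := (WeierstrassCurve.Affine.equation_iff _ _).mp h.1
    have h6 : (model t).a₆ = (model t).a₂ * (model t).a₄ := rfl
    have h1 : (model t).a₁ = quarticCoeff t 3 / leadRoot t := rfl
    have h2 : (model t).a₂ = quarticCoeff t 2 - quarticCoeff t 3 ^ 2 / (4 * leadRoot t ^ 2) := rfl
    have h3 : (model t).a₃ = 2 * leadRoot t * quarticCoeff t 1 := rfl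
    have h4 : (model t).a₄ = -4 * leadRoot t ^ 2 * quarticCoeff t 0 := rfl
    -- a preimage is determined by its first coordinate
    suffices hs : (X = -(model t).a₂ ∧ Y = (model t).a₁ * (model t).a₂ - (model t).a₃) ∨
        ∃ x, Y = 2 * leadRoot t * x * (X + (model t).a₂) ∧
        OnCurve t x ((X - quarticCoeff t 3 * x) / (2 * leadRoot t) - leadRoot t * x ^ 2) by
      rcases hs with ⟨rfl, rfl⟩ | ⟨x, hYx, hx⟩
      · exact ⟨.infMinus, rfl⟩
      · refine ⟨.affine _ _ hx, ?_⟩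
        have hX : cubicX (leadRoot t) (quarticCoeff t 3) x
            ((X - quarticCoeff t 3 * x) / (2 * leadRoot t) - leadRoot t * x ^ 2) = X := by
          simp only [cubicX]; field_simp; ring
        simp only [toPoint, Point.some.injEq]
        rw [hY, hX, hYx]
        exact ⟨rfl, rfl⟩
    by_cases hX : X = -(model t).a₂
    · by_cases hY0 : Y = (model t).a₁ * (model t).a₂ - (model t).a₃
      · exact .inl ⟨hX, hY0⟩
      right
      have hYz : Y = 0 := by
        have : Y * (Y - ((model t).a₁ * (model t).a₂ - (model t).a₃)) = 0 := by
          rw [hX] at heq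
          rw [h6] at heq
          linear_combination heq
        exact (mul_eq_zero.mp this).resolve_right (sub_ne_zero.mpr hY0)
      rw [hYz] at hY0
      have hd : (model t).a₃ - (model t).a₁ * (model t).a₂ ≠ 0 :=
        fun h0 => hY0 (by linear_combination h0)
      refine ⟨((model t).a₂ ^ 2 + (model t).a₄) / (2 * leadRoot t * ((model t).a₃ - (model t).a₁
        * (model t).a₂)), by rw [hX, hYz]; ring, ?_⟩
      generalize hx : ((model t).a₂ ^ 2 + (model t).a₄) / (2 * leadRoot t * ((model t).a₃
        - (model t).a₁ * (model t).a₂)) = x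
      rw [div_eq_iff (mul_ne_zero (mul_ne_zero two_ne_zero hq) hd)] at hx
      rw [onCurve_iff, hX]
      rw [h1, h2, h3, h4] at hx
      rw [h2]
      field_simp at hx ⊢
      linear_combination hx
    · right
      have hX' : X + (model t).a₂ ≠ 0 := fun h0 => hX (by linear_combination h0)
      refine ⟨Y / (2 * leadRoot t * (X + (model t).a₂)), by field_simp, ?_⟩
      rw [onCurve_iff]
      generalize hx : Y / (2 * leadRoot t * (X + (model t).a₂)) = x
      rw [div_eq_iff (mul_ne_zero (mul_ne_zero two_ne_zero hq) hX')] at hx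
      rw [hx, h6] at heq
      have key : (X + (model t).a₂) * (4 * leadRoot t ^ 2 * x ^ 2 * (X + (model t).a₂)
        + 2 * (model t).a₁ * X * leadRoot t * x + 2 * (model t).a₃ * leadRoot t * x) =
        (X + (model t).a₂) * (X ^ 2 + (model t).a₄) := by linear_combination heq
      have key' := mul_left_cancel₀ hX' key
      rw [h1, h2, h3, h4] at key'
      field_simp at key' ⊢
      linear_combination -key'

/-! ### The discriminant and the eight points -/

theorem coefB_sq_sub : (coefB ^ 2 - 4 * coefA * coefC : ℚ[X]) = ∏ i : Fin 7, (X - C (roots i)) := by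
  apply Polynomial.funext
  intro r
  simp only [coefA, coefB, coefC, eval_sub, eval_pow, eval_mul, eval_add, eval_C, eval_X,
    eval_ofNat, Fin.prod_univ_seven, roots]
  simp only [Matrix.cons_val]
  ring

theorem onCurve_roots {F : Type*} [Field F] [Algebra ℚ F] (t : F) {x : F}
    (h : ∃ i, x = algebraMap ℚ F (roots i)) :
    OnCurve t x (x ^ 2 * (t ^ 2 + aeval x coefB / (2 * x ^ 4))) := by
  obtain ⟨i, rfl⟩ := h
  exact onCurve_P t i

theorem onCurve_of_mem [DecidableEq (RatFunc ℚ)] (x : RatFunc ℚ)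
    (hx : x ∈ ({1, -1, 4, -4, 9, -9, 16} : Finset (RatFunc ℚ))) :
    OnCurve RatFunc.X x (x ^ 2 * (RatFunc.X ^ 2 + aeval x coefB / (2 * x ^ 4))) := by
  apply onCurve_roots
  simp only [Finset.mem_insert, Finset.mem_singleton] at hx
  rcases hx with rfl | rfl | rfl | rfl | rfl | rfl | rfl
  · exact ⟨0, by simp [roots]⟩
  · exact ⟨1, by simp [roots]⟩
  · exact ⟨2, by simp [roots]⟩
  · exact ⟨3, by simp [roots]⟩
  · exact ⟨4, by simp [roots]⟩
  · exact ⟨5, by simp [roots]⟩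
  · exact ⟨6, by simp [roots]⟩

/-! ### Minimality -/

instance E₁_isIntegral : E₁.IsIntegral ℤ := by
  refine ⟨⟨0, -1, 0, -357917711928106838175050781865,
    8790806811671574287759992288018136706011725⟩, ?_⟩
  ext <;> simp [E₁]

theorem E₁_c₄ : E₁.c₄ = (17180050172549128232402437529536 : ℤ) := by
  simp only [WeierstrassCurve.c₄, WeierstrassCurve.b₂, WeierstrassCurve.b₄, E₁]
  norm_num

theorem E₁_Δ : E₁.Δ = (2901084911795746551033445084635940451873949921621136659518122403208460105182697985460000000 : ℤ) := by
  simp only [WeierstrassCurve.Δ, WeierstrassCurve.b₂, WeierstrassCurve.b₄,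
    WeierstrassCurve.b₆, WeierstrassCurve.b₈, E₁]
  norm_num

instance E₁_isElliptic : E₁.IsElliptic := by
  rw [WeierstrassCurve.isElliptic_iff, E₁_Δ]
  norm_num

open IsDedekindDomain IsDedekindDomain.HeightOneSpectrum in
/-- An integral Weierstrass curve over `ℚ_p` is minimal if its invariants are not divisible by
`p ^ 4` and `p ^ 12`, respectively. -/
theorem isMinimal_of_not_dvd (p : ℕ) [Fact p.Prime] (W : WeierstrassCurve ℚ_[p])
    (hW : W.IsIntegral ℤ_[p]) {c d : ℤ} (hc : W.c₄ = c) (hd : W.Δ = d)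
    (h : ¬((p : ℤ) ^ 4 ∣ c ∧ (p : ℤ) ^ 12 ∣ d)) : W.IsMinimal ℤ_[p] := by
  have h1 : (1 : WeierstrassCurve.VariableChange ℚ_[p]) • W = W := one_smul _ _
  refine ⟨by simpa only [h1], fun V hV hle => ?_⟩
  have hV' : (V • W).IsIntegral ℤ_[p] := hV
  simp only [h1]
  rw [← Subtype.coe_le_coe, WeierstrassCurve.valuation_Δ_aux_eq_of_isIntegral,
    WeierstrassCurve.valuation_Δ_aux_eq_of_isIntegral, WeierstrassCurve.variableChange_Δ, map_mul,
    map_pow, Units.val_inv_eq_inv_val, map_inv₀]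
  set v := valuation ℚ_[p] (IsDiscreteValuationRing.maximalIdeal ℤ_[p]) with hv
  have hu0 : v (V.u : ℚ_[p]) ≠ 0 := (Valuation.ne_zero_iff _).mpr V.u.ne_zero
  by_cases hu : 1 ≤ v (V.u : ℚ_[p])
  · exact mul_le_of_le_one_left' (pow_le_one₀ zero_le (inv_le_one_of_one_le₀ hu))
  exfalso
  rw [not_le] at hu
  have hmem : ∀ x : ℚ_[p], ‖x‖ < 1 → v x < 1 := by
    intro x hx
    obtain ⟨X, rfl⟩ : ∃ X : ℤ_[p], algebraMap ℤ_[p] ℚ_[p] X = x := ⟨⟨_, hx.le⟩, rfl⟩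
    exact (valuation_lt_one_iff_mem _ X).mpr
      ((IsLocalRing.mem_maximalIdeal _).mpr (PadicInt.mem_nonunits.mpr hx))
  have hn : ‖(V.u : ℚ_[p])‖ ≤ 1 := by
    by_contra hn
    rw [not_le] at hn
    have := hmem (V.u : ℚ_[p])⁻¹ (by rw [norm_inv]; exact inv_lt_one_of_one_lt₀ hn)
    rw [map_inv₀, inv_lt_one₀ (zero_lt_iff.mpr hu0)] at this
    exact absurd hu (not_lt.mpr this.le)
  obtain ⟨U, hU⟩ : ∃ U : ℤ_[p], algebraMap ℤ_[p] ℚ_[p] U = V.u := ⟨⟨_, hn⟩, rfl⟩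
  have hpU : (p : ℤ_[p]) ∣ U := by
    rw [← hU, hv, valuation_lt_one_iff_mem] at hu
    exact PadicInt.norm_lt_one_iff_dvd U |>.mp
      (PadicInt.mem_nonunits.mp ((IsLocalRing.mem_maximalIdeal _).mp hu))
  have key : ∀ (n : ℕ) (a : ℤ) (r : ℤ_[p]),
      algebraMap ℤ_[p] ℚ_[p] r = (V.u : ℚ_[p])⁻¹ ^ n * a → (p : ℤ) ^ n ∣ a := by
    intro n a r hr
    have h2 : (a : ℤ_[p]) = U ^ n * r := by
      apply IsFractionRing.injective ℤ_[p] ℚ_[p]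
      rw [map_mul, map_pow, hU, hr, ← mul_assoc, ← mul_pow, mul_inv_cancel₀ V.u.ne_zero, one_pow,
        one_mul, map_intCast]
    rw [← PadicInt.pow_p_dvd_int_iff, h2]
    exact (pow_dvd_pow_of_dvd hpU n).mul_right r
  refine h ⟨key 4 c ((V • W).integralModel ℤ_[p]).c₄ ?_,
    key 12 d ((V • W).integralModel ℤ_[p]).Δ ?_⟩
  · rw [WeierstrassCurve.integralModel_c₄_eq ℤ_[p] (V • W), WeierstrassCurve.variableChange_c₄, hc,
      Units.val_inv_eq_inv_val]
  · rw [WeierstrassCurve.integralModel_Δ_eq ℤ_[p] (V • W), WeierstrassCurve.variableChange_Δ, hd,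
      Units.val_inv_eq_inv_val]

theorem E₁_isMinimal (p : ℕ) [hp : Fact p.Prime] :
    (E₁.map (algebraMap ℚ ℚ_[p])).IsMinimal ℤ_[p] := by
  refine isMinimal_of_not_dvd p _ ?_ (by rw [WeierstrassCurve.map_c₄, E₁_c₄, map_intCast])
    (by rw [WeierstrassCurve.map_Δ, E₁_Δ, map_intCast]) ?_
  · refine ⟨⟨0, -1, 0, -357917711928106838175050781865,
      8790806811671574287759992288018136706011725⟩, ?_⟩
    ext <;> simp [E₁] <;> exact (map_ofNat (algebraMap ℤ_[p] ℚ_[p]) _).symm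
  · rintro ⟨h4, h12⟩
    have h1 : (p : ℤ) ∣ 2 ^ 6 := by
      have := Int.dvd_gcd ((dvd_pow_self _ (by norm_num)).trans h4)
        ((dvd_pow_self _ (by norm_num)).trans h12)
      have hg : (Int.gcd 17180050172549128232402437529536 2901084911795746551033445084635940451873949921621136659518122403208460105182697985460000000) = 2 ^ 6 := by norm_num
      rw [hg] at this
      exact_mod_cast this
    have h2 : p = 2 := by
      have := Int.Prime.dvd_pow' hp.out h1
      exact (Nat.prime_dvd_prime_iff_eq hp.out Nat.prime_two).mp (by exact_mod_cast this)
    subst h2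
    revert h12
    norm_num

/-! ### The parallelogram law -/

section Parallelogram

open MvPolynomial WeierstrassCurve

variable {K : Type*} [Field K] {W : WeierstrassCurve K}

theorem eval_addSubMap (s t u : K) : (fun i => (addSubMap W i).eval ![s, t, u]) =
    ![s ^ 2 - W.b₄ * s * u - W.b₆ * t * u - W.b₈ * u ^ 2,
      2 * t * s + W.b₂ * s * u + W.b₄ * t * u + W.b₆ * u ^ 2, t ^ 2 - 4 * s * u] := by
  ext i
  fin_cases i <;> simp [addSubMap]

variable [DecidableEq K]

theorem eval_addSubMap_sym2x_self [W.IsElliptic] (P : W.toAffine.Point) : ∃ c : K, c ≠ 0 ∧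
    (fun i => (addSubMap W i).eval (P.sym2x P)) = c • (P + P).sym2x 0 := by
  have hne := addSubMap_ne_zero W (x := P.sym2x P) (Point.sym2x_ne_zero P P)
  rcases P with _ | ⟨x, y, h⟩
  · refine ⟨1, one_ne_zero, ?_⟩
    rw [← Point.zero_def, add_zero, Point.sym2x_zero_zero, eval_addSubMap]
    simp
  have he := (equation_iff _ _).mp h.1
  rw [Point.sym2x_some_some, eval_addSubMap] at hne ⊢
  have h2 : 2 * (x + x) * (x * x) + W.b₂ * (x * x) * 1 + W.b₄ * (x + x) * 1 + W.b₆ * 1 ^ 2 =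
      (y - W.toAffine.negY x y) ^ 2 := by
    simp only [negY, b₂, b₄, b₆]
    linear_combination -4 * he
  have h3 : (x + x) ^ 2 - 4 * (x * x) * 1 = 0 := by ring
  rw [h2, h3] at hne ⊢
  by_cases hy : y = W.toAffine.negY x y
  · rw [Point.add_self_of_Y_eq hy, Point.sym2x_zero_zero, sub_eq_zero.mpr hy] at *
    refine ⟨(x * x) ^ 2 - W.b₄ * (x * x) * 1 - W.b₆ * (x + x) * 1 - W.b₈ * 1 ^ 2,
      fun h0 => hne ?_, ?_⟩
    · rw [h0]
      ext i
      fin_cases i <;> simp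
    · ext i
      fin_cases i <;> simp
  · have hy' := sub_ne_zero.mpr hy
    rw [Point.add_self_of_Y_ne hy, Point.sym2x_some_zero]
    refine ⟨_, pow_ne_zero 2 hy', ?_⟩
    rw [slope_of_Y_ne rfl hy]
    have h1 : (x * x) ^ 2 - W.b₄ * (x * x) * 1 - W.b₆ * (x + x) * 1 - W.b₈ * 1 ^ 2 =
        (y - W.toAffine.negY x y) ^ 2 * W.toAffine.addX x x
          ((3 * x ^ 2 + 2 * W.a₂ * x + W.a₄ - W.a₁ * y) / (y - W.toAffine.negY x y)) := by
      simp only [addX]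
      field_simp
      simp only [negY, b₄, b₆, b₈]
      linear_combination (W.a₁ ^ 2 + 8 * x + 4 * W.a₂) * he
    rw [h1]
    ext i
    fin_cases i <;> simp

theorem eval_addSubMap_sym2x [W.IsElliptic] (P Q : W.toAffine.Point) : ∃ c : K, c ≠ 0 ∧
    (fun i => (addSubMap W i).eval (P.sym2x Q)) = c • (P + Q).sym2x (P - Q) := by
  rcases eq_or_ne P Q with rfl | hPQ
  · rw [sub_self]
    exact eval_addSubMap_sym2x_self P
  rcases eq_or_ne P (-Q) with rfl | hPQ'
  · obtain ⟨c, hc, h⟩ := eval_addSubMap_sym2x_self (-Q)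
    refine ⟨c, hc, ?_⟩
    rw [neg_add_cancel, Point.sym2x_comm 0, sub_eq_add_neg, ← h, Point.sym2x_neg_right]
  rcases P with _ | ⟨x₁, y₁, h₁⟩ <;> rcases Q with _ | ⟨x₂, y₂, h₂⟩
  · exact absurd rfl hPQ
  · refine ⟨1, one_ne_zero, ?_⟩
    rw [← Point.zero_def, zero_add, zero_sub, Point.sym2x_neg_right, Point.sym2x_zero_some,
      Point.sym2x_some_some, eval_addSubMap]
    ext i
    fin_cases i <;> simp <;> ring
  · refine ⟨1, one_ne_zero, ?_⟩
    rw [← Point.zero_def, add_zero, sub_zero, Point.sym2x_some_zero,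
      Point.sym2x_some_some, eval_addSubMap]
    ext i
    fin_cases i <;> simp <;> ring
  · have hx : x₁ ≠ x₂ := by
      intro hx
      rcases Point.X_eq_iff (h₁ := h₁) (h₂ := h₂) |>.mp hx with h | h
      · exact hPQ h
      · exact hPQ' h
    have hx' := sub_ne_zero.mpr hx
    refine ⟨(x₁ - x₂) ^ 2, pow_ne_zero 2 hx', ?_⟩
    have e1 := (equation_iff _ _).mp h₁.1
    have e2 := (equation_iff _ _).mp h₂.1
    rw [sub_eq_add_neg (Point.some x₁ y₁ h₁), Point.neg_some, Point.add_of_X_ne hx, Point.add_of_X_ne hx,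
      Point.sym2x_some_some, Point.sym2x_some_some, eval_addSubMap, slope_of_X_ne hx,
      slope_of_X_ne hx]
    have k1 : 2 * (x₁ + x₂) * (x₁ * x₂) + W.b₂ * (x₁ * x₂) * 1 + W.b₄ * (x₁ + x₂) * 1
        + W.b₆ * 1 ^ 2 = (x₁ - x₂) ^ 2 * (W.toAffine.addX x₁ x₂ ((y₁ - y₂) / (x₁ - x₂))
        + W.toAffine.addX x₁ x₂ ((y₁ - W.toAffine.negY x₂ y₂) / (x₁ - x₂))) := by
      simp only [addX, negY, b₂, b₄, b₆]
      field_simp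
      linear_combination -2 * e1 - 2 * e2
    have k2 : (x₁ * x₂) ^ 2 - W.b₄ * (x₁ * x₂) * 1 - W.b₆ * (x₁ + x₂) * 1
        - W.b₈ * 1 ^ 2 = (x₁ - x₂) ^ 2 * (W.toAffine.addX x₁ x₂ ((y₁ - y₂) / (x₁ - x₂))
        * W.toAffine.addX x₁ x₂ ((y₁ - W.toAffine.negY x₂ y₂) / (x₁ - x₂))) := by
      have e1' : W.a₆ = y₁ ^ 2 + W.a₁ * x₁ * y₁ + W.a₃ * y₁ - (x₁ ^ 3 + W.a₂ * x₁ ^ 2 + W.a₄ * x₁) := by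
        linear_combination -e1
      have e2' : W.a₄ * (x₁ - x₂) = y₁ ^ 2 + W.a₁ * x₁ * y₁ + W.a₃ * y₁ - (y₂ ^ 2 + W.a₁ * x₂ * y₂ +
          W.a₃ * y₂) - (x₁ ^ 3 + W.a₂ * x₁ ^ 2) + (x₂ ^ 3 + W.a₂ * x₂ ^ 2) := by
        linear_combination -e1 + e2
      have e2'' := eq_div_of_mul_eq hx' e2'
      simp only [addX, negY, b₄, b₆, b₈]
      rw [e1', e2'']
      field_simp
      ring
    rw [k1, k2]
    ext i
    fin_cases i <;> simp
    ring

end Parallelogram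

theorem naiveHeight_eq {W : WeierstrassCurve ℚ} (P : W.toAffine.Point) :
    naiveHeight P = Height.logHeight P.xRep := by
  rcases P with _ | ⟨x, y, h⟩
  · change 0 = Height.logHeight ![(1 : ℚ), 0]
    have := Height.logHeight₁_div_eq_logHeight (1 : ℚ) 0
    rw [← this, div_zero, Height.logHeight₁_zero]
  · exact Height.logHeight₁_eq_logHeight x

theorem abs_naiveHeight_add_sub_le (W : WeierstrassCurve ℚ) [W.IsElliptic] :
    ∃ C, ∀ P Q : W.toAffine.Point, |naiveHeight (P + Q) + naiveHeight (P - Q)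
      - 2 * (naiveHeight P + naiveHeight Q)| ≤ C := by
  obtain ⟨C₁, h₁⟩ := W.abs_logHeight_addSubMap_sub_two_mul_logHeight_le
  obtain ⟨C₂, h₂⟩ := Height.abs_logHeight_sym2_sub_le ℚ
  have hs : ∀ P Q : W.toAffine.Point,
      |Height.logHeight (P.sym2x Q) - (naiveHeight P + naiveHeight Q)| ≤ C₂ := by
    intro P Q
    have e : ∀ R : W.toAffine.Point, R.xRep = ![R.xRep 0, R.xRep 1] := by
      intro R
      ext i
      fin_cases i <;> rfl
    rw [naiveHeight_eq, naiveHeight_eq, e P, e Q]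
    exact h₂ (by rw [← e]; exact P.xRep_ne_zero) (by rw [← e]; exact Q.xRep_ne_zero)
  refine ⟨C₁ + C₂ + 2 * C₂, fun P Q => ?_⟩
  obtain ⟨c, hc, he⟩ := eval_addSubMap_sym2x P Q
  have h3 := h₁ (P.sym2x Q)
  rw [he, Height.logHeight_smul_eq_logHeight _ hc] at h3
  have h4 := hs P Q
  have h5 := hs (P + Q) (P - Q)
  rw [abs_le] at *
  constructor <;> linarith [h3.1, h3.2, h4.1, h4.2, h5.1, h5.2]

theorem exists_isCanonicalHeight (W : WeierstrassCurve ℚ) [W.IsElliptic] :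
    ∃ H : W.toAffine.Point → ℝ, IsCanonicalHeight H := by
  obtain ⟨C, hC⟩ := abs_naiveHeight_add_sub_le W
  suffices h : ∀ P : W.toAffine.Point, ∃ a, Filter.Tendsto
      (fun n : ℕ => naiveHeight ((2 ^ n : ℕ) • P) / 4 ^ n) Filter.atTop (nhds a) by
    choose H hH using h
    exact ⟨H, hH⟩
  intro P
  refine cauchySeq_tendsto_of_complete (cauchySeq_of_le_geometric (1 / 4) (C / 4) (by norm_num) ?_)
  intro n
  have h := hC ((2 ^ n : ℕ) • P) ((2 ^ n : ℕ) • P)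
  have h0 : naiveHeight (0 : W.toAffine.Point) = 0 := rfl
  rw [sub_self, h0, ← two_nsmul, smul_smul, ← pow_succ'] at h
  rw [Real.dist_eq, abs_sub_comm, pow_succ (4 : ℝ) n, div_sub_div _ _ (by positivity) (by positivity),
    abs_div, abs_of_pos (a := (4 : ℝ) ^ n * 4 * 4 ^ n) (by positivity), div_le_iff₀ (by positivity)]
  have e : naiveHeight ((2 ^ (n + 1) : ℕ) • P) * 4 ^ n - 4 ^ n * 4 * naiveHeight ((2 ^ n : ℕ) • P)
      = 4 ^ n * (naiveHeight ((2 ^ (n + 1) : ℕ) • P) + 0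
        - 2 * (naiveHeight ((2 ^ n : ℕ) • P) + naiveHeight ((2 ^ n : ℕ) • P))) := by ring
  rw [e, abs_mul, abs_of_pos (by positivity)]
  refine (mul_le_mul_of_nonneg_left h (by positivity)).trans (le_of_eq ?_)
  rw [one_div, inv_pow]
  field_simp

section Canonical

variable {W : WeierstrassCurve ℚ} [W.IsElliptic] {H : W.toAffine.Point → ℝ}

theorem IsCanonicalHeight.parallelogram (hH : IsCanonicalHeight H) (P Q : W.toAffine.Point) :
    H (P + Q) + H (P - Q) = 2 * (H P + H Q) := by
  obtain ⟨C, hC⟩ := abs_naiveHeight_add_sub_le W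
  have h1 := ((hH (P + Q)).add (hH (P - Q))).sub (((hH P).add (hH Q)).const_mul 2)
  have h2 : Filter.Tendsto (fun n : ℕ => C * (1 / 4 : ℝ) ^ n) Filter.atTop (nhds 0) := by
    simpa using (tendsto_pow_atTop_nhds_zero_of_lt_one (r := (1 / 4 : ℝ)) (by norm_num)
      (by norm_num)).const_mul C
  refine sub_eq_zero.mp (tendsto_nhds_unique h1 (squeeze_zero_norm (fun n : ℕ => ?_) h2))
  · have h := hC ((2 ^ n : ℕ) • P) ((2 ^ n : ℕ) • Q)
    rw [← nsmul_add, ← nsmul_sub] at h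
    rw [Real.norm_eq_abs, ← add_div, ← add_div, mul_div_assoc', ← sub_div, abs_div,
      abs_of_pos (a := (4 : ℝ) ^ n) (by positivity), one_div, inv_pow, ← div_eq_mul_inv]
    gcongr

theorem IsCanonicalHeight.zero (hH : IsCanonicalHeight H) : H 0 = 0 := by
  have := hH.parallelogram 0 0
  rw [add_zero, sub_zero] at this
  linarith

theorem IsCanonicalHeight.pairing_add (hH : IsCanonicalHeight H) (P Q R : W.toAffine.Point) :
    H (P + (Q + R)) - H P - H (Q + R) = (H (P + Q) - H P - H Q) + (H (P + R) - H P - H R) := by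
  have a := hH.parallelogram (P + R) Q
  have b := hH.parallelogram (P - Q) R
  have c := hH.parallelogram P (Q + R)
  have d := hH.parallelogram P Q
  rw [show P + R + Q = P + (Q + R) by abel, show P + R - Q = P - Q + R by abel] at a
  rw [show P - Q - R = P - (Q + R) by abel] at b
  linarith

theorem IsCanonicalHeight.linearIndependent (hH : IsCanonicalHeight H) {n : ℕ}
    {P : Fin n → W.toAffine.Point} (hdet : (heightMatrix H P).det ≠ 0) :
    LinearIndependent ℤ P := by
  rw [Fintype.linearIndependent_iff]
  intro c hc
  have h : (heightMatrix H P).mulVec (fun j => (c j : ℝ)) = 0 := by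
    ext i
    let f : W.toAffine.Point →+ ℝ := AddMonoidHom.mk' (fun Q => (H (P i + Q) - H (P i) - H Q) / 2)
      (fun Q R => by rw [hH.pairing_add]; ring)
    have h1 := congrArg f hc
    rw [map_sum, map_zero] at h1
    simp only [map_zsmul, zsmul_eq_mul] at h1
    rw [Pi.zero_apply, ← h1]
    change ∑ j, heightMatrix H P i j * (c j : ℝ) = _
    exact Finset.sum_congr rfl fun j _ => mul_comm (heightMatrix H P i j) _
  have h0 := Matrix.eq_zero_of_mulVec_eq_zero hdet h
  intro i
  simpa using congrFun h0 i

theorem IsCanonicalHeight.heightMatrix_self (hH : IsCanonicalHeight H) {n : ℕ}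
    (P : Fin n → W.toAffine.Point) (i : Fin n) : heightMatrix H P i i = H (P i) := by
  have := hH.parallelogram (P i) (P i)
  rw [sub_self, hH.zero] at this
  simp only [heightMatrix, Matrix.of_apply]
  linarith

end Canonical

/-! ### Duplication on `E₁` in homogeneous integral coordinates -/

/-- The binary quartic form with the given coefficients. -/
def quartic {R : Type*} [CommRing R] (c₄ c₃ c₂ c₁ c₀ : ℤ) (m n : R) : R :=
  c₄ * m ^ 4 + c₃ * (m ^ 3 * n) + c₂ * (m ^ 2 * n ^ 2) + c₁ * (m * n ^ 3) + c₀ * n ^ 4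

/-- The numerator of the first coordinate of the double of a point on `E₁`. -/
def dupNum {R : Type*} [CommRing R] (m n : R) : R :=
  quartic (1) (0) (715835423856213676350101563730) (-70326454493372594302079938304145093648093800) (128105088511851307190732736061349272392917714044094636925125) m n

/-- The denominator of the first coordinate of the double of a point on `E₁`. -/
def dupDen {R : Type*} [CommRing R] (m n : R) : R :=
  quartic (0) (4) (-4) (-1431670847712427352700203127460) (35163227246686297151039969152072546824046900) m n

theorem cast_quartic {R : Type*} [CommRing R] (c₄ c₃ c₂ c₁ c₀ m n : ℤ) :
    ((quartic c₄ c₃ c₂ c₁ c₀ m n : ℤ) : R) = quartic c₄ c₃ c₂ c₁ c₀ (m : R) (n : R) := by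
  simp [quartic]

theorem quartic_smul {R : Type*} [CommRing R] (c₄ c₃ c₂ c₁ c₀ : ℤ) (s m n : R) :
    quartic c₄ c₃ c₂ c₁ c₀ (s * m) (s * n) = s ^ 4 * quartic c₄ c₃ c₂ c₁ c₀ m n := by
  simp only [quartic]
  ring

theorem abs_quartic_le (c₄ c₃ c₂ c₁ c₀ m n : ℤ) {M : ℤ} (hm : |m| ≤ M) (hn : |n| ≤ M) :
    |quartic c₄ c₃ c₂ c₁ c₀ m n| ≤ (|c₄| + |c₃| + |c₂| + |c₁| + |c₀|) * M ^ 4 := by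
  have hM : 0 ≤ M := (abs_nonneg m).trans hm
  have key : ∀ (c : ℤ) (i j : ℕ), i + j = 4 → |c * (m ^ i * n ^ j)| ≤ |c| * M ^ 4 := by
    intro c i j h
    rw [abs_mul, abs_mul, abs_pow, abs_pow, ← h, pow_add]
    gcongr
  have h4 := key c₄ 4 0 rfl
  have h3 := key c₃ 3 1 rfl
  have h2 := key c₂ 2 2 rfl
  have h1 := key c₁ 1 3 rfl
  have h0 := key c₀ 0 4 rfl
  simp only [pow_zero, pow_one, mul_one, one_mul] at h4 h3 h1 h0
  simp only [quartic, Int.cast_id]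
  rw [abs_le] at *
  constructor <;> linarith [h4.1, h4.2, h3.1, h3.2, h2.1, h2.2, h1.1, h1.2, h0.1, h0.2]

/-- The discriminant of `E₁`. -/
def discE₁ : ℤ :=
  2901084911795746551033445084635940451873949921621136659518122403208460105182697985460000000

theorem discE₁_mul_left (m n : ℤ) :
    quartic (2901084911795746551033445084635940451873949921621136659518122403208460105182697985460000000) (18018353355194911093432660920033545773118045868449197653478608229877174284978639633737240335810735750000) (-777987795835757141679367635017674355471321431904282652319713648626788758019995516598393494895912993214948727928814500000) (19086397444754819057999301076576343794868644872621656593898645334444133171800009022919415770677002684082272702549555594866846298750000) (0) m n * dupNum m n +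
    quartic (-4504588338798727773358165230008386443279511467112299413369652057469293571244659908434310083952683937500) (-324677887910604344007812312310685894267793160157491757049168080361139086154271720144109921345252658383039602811930312500) (41397338792311707543396858647747288144610195777249831643576229796207023411866904906574771101055140134331395420826065705185708114687500) (-69534705016676365097405802656134099700313812042608246010903760980576040142273286152502146020424253968744085365509067478147400496053942667359267187500) (0) m n * dupDen m n =
      discE₁ * m ^ 8 := by
  simp only [quartic, dupNum, dupDen, discE₁, Int.cast_id]
  ring

theorem discE₁_mul_right (m n : ℤ) :
    quartic (0) (0) (-48) (32) (22906733563398837643203250039376) m n * dupNum m n +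
    quartic (0) (12) (4) (7158354238562136763501015637300) (-949407135660527159736383742251253363843011380) m n * dupDen m n =
      discE₁ * n ^ 8 := by
  simp only [quartic, dupNum, dupDen, discE₁, Int.cast_id]
  ring

theorem gcd_dup_dvd {m n : ℤ} (h : Int.gcd m n = 1) :
    (Int.gcd (dupNum m n) (dupDen m n) : ℤ) ∣ discE₁ := by
  have hm : (Int.gcd (dupNum m n) (dupDen m n) : ℤ) ∣ discE₁ * m ^ 8 := by
    rw [← discE₁_mul_left m n]
    exact dvd_add (Int.gcd_dvd_left _ _ |>.mul_left _) (Int.gcd_dvd_right _ _ |>.mul_left _)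
  have hn : (Int.gcd (dupNum m n) (dupDen m n) : ℤ) ∣ discE₁ * n ^ 8 := by
    rw [← discE₁_mul_right m n]
    exact dvd_add (Int.gcd_dvd_left _ _ |>.mul_left _) (Int.gcd_dvd_right _ _ |>.mul_left _)
  obtain ⟨a, b, hab⟩ : IsCoprime (m ^ 8) (n ^ 8) :=
    IsCoprime.pow (Int.isCoprime_iff_gcd_eq_one.mpr h)
  have : discE₁ = a * (discE₁ * m ^ 8) + b * (discE₁ * n ^ 8) := by
    linear_combination -discE₁ * hab
  rw [this]
  exact dvd_add (hm.mul_left _) (hn.mul_left _)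

theorem gcd_dup_pos {m n : ℤ} (h : Int.gcd m n = 1) :
    0 < Int.gcd (dupNum m n) (dupDen m n) := by
  refine Nat.pos_of_ne_zero fun h0 => ?_
  have := gcd_dup_dvd h
  rw [h0] at this
  revert this
  simp [discE₁]

set_option exponentiation.threshold 500 in
theorem abs_dup_le (m n : ℤ) :
    max |dupNum m n| |dupDen m n| ≤ 2 ^ 496 * max |m| |n| ^ 4 := by
  have hM : 0 ≤ max |m| |n| ^ 4 := by positivity
  refine max_le ?_ ?_
  · refine (abs_quartic_le _ _ _ _ _ m n (le_max_left _ _) (le_max_right _ _)).trans ?_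
    gcongr
    norm_num
  · refine (abs_quartic_le _ _ _ _ _ m n (le_max_left _ _) (le_max_right _ _)).trans ?_
    gcongr
    norm_num

set_option exponentiation.threshold 500 in
theorem le_abs_dup (m n : ℤ) :
    discE₁ * max |m| |n| ^ 4 ≤ 2 ^ 496 * max |dupNum m n| |dupDen m n| := by
  rcases eq_or_lt_of_le (show 0 ≤ max |m| |n| ^ 4 by positivity) with h0 | h0
  · rw [← h0, mul_zero]; positivity
  have hM : 0 ≤ max |m| |n| ^ 4 := by positivity
  have key : ∀ (u v x : ℤ), u * dupNum m n + v * dupDen m n = discE₁ * x ^ 8 →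
      |u| ≤ 2 ^ 495 * max |m| |n| ^ 4 → |v| ≤ 2 ^ 495 * max |m| |n| ^ 4 →
      discE₁ * |x| ^ 8 ≤ max |m| |n| ^ 4 * (2 ^ 496 * max |dupNum m n| |dupDen m n|) := by
    intro u v x h hu hv
    have hd : discE₁ = |discE₁| := by simp [discE₁]
    calc discE₁ * |x| ^ 8 = |u * dupNum m n + v * dupDen m n| := by
          rw [h, abs_mul, abs_pow, ← hd]
      _ ≤ |u| * |dupNum m n| + |v| * |dupDen m n| := by
          rw [← abs_mul, ← abs_mul]; exact abs_add_le _ _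
      _ ≤ (2 ^ 495 * max |m| |n| ^ 4) * max |dupNum m n| |dupDen m n|
          + (2 ^ 495 * max |m| |n| ^ 4) * max |dupNum m n| |dupDen m n| := by
          gcongr
          · exact le_max_left _ _
          · exact le_max_right _ _
      _ = _ := by ring
  have hm := key _ _ m (discE₁_mul_left m n)
    ((abs_quartic_le _ _ _ _ _ m n (le_max_left _ _) (le_max_right _ _)).trans
      (mul_le_mul_of_nonneg_right (by norm_num) hM))
    ((abs_quartic_le _ _ _ _ _ m n (le_max_left _ _) (le_max_right _ _)).trans
      (mul_le_mul_of_nonneg_right (by norm_num) hM))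
  have hn := key _ _ n (discE₁_mul_right m n)
    ((abs_quartic_le _ _ _ _ _ m n (le_max_left _ _) (le_max_right _ _)).trans
      (mul_le_mul_of_nonneg_right (by norm_num) hM))
    ((abs_quartic_le _ _ _ _ _ m n (le_max_left _ _) (le_max_right _ _)).trans
      (mul_le_mul_of_nonneg_right (by norm_num) hM))
  have h8 : discE₁ * max |m| |n| ^ 8 ≤
      max |m| |n| ^ 4 * (2 ^ 496 * max |dupNum m n| |dupDen m n|) := by
    rcases max_cases |m| |n| with ⟨h, -⟩ | ⟨h, -⟩
    · rw [h] at hm ⊢; exact hm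
    · rw [h] at hn ⊢; exact hn
  refine le_of_mul_le_mul_left ?_ h0
  calc _ = discE₁ * max |m| |n| ^ 8 := by ring
    _ ≤ _ := h8

/-- The integers `m`, `n` are coprime homogeneous coordinates of the first coordinate of `P`. -/
def IsRep {W : WeierstrassCurve ℚ} (P : W.toAffine.Point) (m n : ℤ) : Prop :=
  Int.gcd m n = 1 ∧ ∃ c : ℚ, c ≠ 0 ∧ P.xRep = c • ![(m : ℚ), (n : ℚ)]

theorem isRep_some {W : WeierstrassCurve ℚ} {x y : ℚ} (h : W.toAffine.Nonsingular x y) :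
    IsRep (.some x y h : W.toAffine.Point) x.num x.den := by
  refine ⟨x.reduced, (x.den : ℚ)⁻¹, by simp, ?_⟩
  have hx : (x.den : ℚ)⁻¹ * x.num = x := by
    rw [mul_comm, ← div_eq_mul_inv, x.num_div_den]
  ext i
  fin_cases i
  · simp [Point.xRep, hx]
  · simp [Point.xRep]

theorem exists_isRep {W : WeierstrassCurve ℚ} (P : W.toAffine.Point) : ∃ m n, IsRep P m n := by
  rcases P with _ | ⟨x, y, h⟩
  · exact ⟨1, 0, by simp, 1, one_ne_zero, by simp [Point.xRep]⟩
  · exact ⟨_, _, isRep_some h⟩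

theorem IsRep.naiveHeight_eq {W : WeierstrassCurve ℚ} {P : W.toAffine.Point} {m n : ℤ}
    (h : IsRep P m n) : naiveHeight P = Real.log (max |m| |n| : ℤ) := by
  obtain ⟨hg, c, hc, e⟩ := h
  rw [RankEight.naiveHeight_eq, e, Height.logHeight_smul_eq_logHeight _ hc]
  have hx : (Finset.univ : Finset (Fin 2)).gcd ![m, n] = 1 := by
    have hg' : Int.gcd m |n| = 1 := by rwa [Int.gcd, Int.natAbs_abs]
    simpa [Finset.univ_fin2, ← Int.abs_eq_normalize, ← Int.coe_gcd] using hg'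
  have he : ((↑) : ℤ → ℚ) ∘ ![m, n] = ![(m : ℚ), (n : ℚ)] := by
    ext i
    fin_cases i <;> rfl
  rw [← he, Rat.logHeight_eq_max_abs_of_gcd_eq_one hx]
  congr 2
  refine le_antisymm (ciSup_le fun i => ?_) (max_le ?_ ?_)
  · fin_cases i
    · exact le_max_left _ _
    · exact le_max_right _ _
  · exact Finite.le_ciSup_of_le (f := fun i => |![m, n] i|) 0 le_rfl
  · exact Finite.le_ciSup_of_le (f := fun i => |![m, n] i|) 1 le_rfl

theorem IsRep.dup {P : E₁.toAffine.Point} {m n : ℤ} (h : IsRep P m n) :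
    IsRep (P + P) (dupNum m n / Int.gcd (dupNum m n) (dupDen m n))
      (dupDen m n / Int.gcd (dupNum m n) (dupDen m n)) := by
  have hg := gcd_dup_pos h.1
  obtain ⟨-, c, hc, e⟩ := h
  have hg0 : (Int.gcd (dupNum m n) (dupDen m n) : ℚ) ≠ 0 := by exact_mod_cast hg.ne'
  refine ⟨Int.gcd_ediv_gcd_ediv_gcd hg, ?_⟩
  obtain ⟨d, hd, hd'⟩ := eval_addSubMap_sym2x_self P
  have hs : P.sym2x P = ![c ^ 2 * (m : ℚ) ^ 2, c ^ 2 * (2 * m * n), c ^ 2 * (n : ℚ) ^ 2] := by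
    ext i
    fin_cases i <;> simp [Point.sym2x, e] <;> ring
  have hs' : (P + P).sym2x 0 = ![(P + P).xRep 0, (P + P).xRep 1, 0] := by
    simp [Point.sym2x]
  rw [hs, hs', eval_addSubMap] at hd'
  have h0 := congrFun hd' 0
  have h1 := congrFun hd' 1
  simp only [Matrix.cons_val, Pi.smul_apply, smul_eq_mul, WeierstrassCurve.b₂,
    WeierstrassCurve.b₄, WeierstrassCurve.b₆, WeierstrassCurve.b₈, E₁] at h0 h1
  have e0 : c ^ 4 * ((dupNum m n : ℤ) : ℚ) = d * (P + P).xRep 0 := by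
    refine Eq.trans ?_ h0
    rw [dupNum, cast_quartic, quartic]
    push_cast
    ring
  have e1 : c ^ 4 * ((dupDen m n : ℤ) : ℚ) = d * (P + P).xRep 1 := by
    refine Eq.trans ?_ h1
    rw [dupDen, cast_quartic, quartic]
    push_cast
    ring
  refine ⟨d⁻¹ * c ^ 4 * Int.gcd (dupNum m n) (dupDen m n), by positivity, ?_⟩
  rw [Int.cast_div (Int.gcd_dvd_left _ _) (by exact_mod_cast hg0),
    Int.cast_div (Int.gcd_dvd_right _ _) (by exact_mod_cast hg0)]
  ext i
  fin_cases i
  · simp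
    field_simp
    linear_combination -e0
  · simp
    field_simp
    linear_combination -e1

theorem IsRep.max_pos {W : WeierstrassCurve ℚ} {P : W.toAffine.Point} {m n : ℤ}
    (h : IsRep P m n) : 0 < max |m| |n| := by
  rcases eq_or_ne m 0 with rfl | hm
  · rcases eq_or_ne n 0 with rfl | hn
    · exact absurd h.1 (by simp)
    · exact lt_max_of_lt_right (abs_pos.mpr hn)
  · exact lt_max_of_lt_left (abs_pos.mpr hm)

set_option exponentiation.threshold 500 in
theorem abs_naiveHeight_dup_le (P : E₁.toAffine.Point) :
    |naiveHeight (P + P) - 4 * naiveHeight P| ≤ 496 * Real.log 2 := by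
  obtain ⟨m, n, h⟩ := exists_isRep P
  rw [h.dup.naiveHeight_eq, h.naiveHeight_eq]
  have hp := h.max_pos
  have hp' := h.dup.max_pos
  have hg := gcd_dup_pos h.1
  have hgd := Int.le_of_dvd (by norm_num [discE₁]) (gcd_dup_dvd h.1)
  have hu := abs_dup_le m n
  have hl := le_abs_dup m n
  generalize hgg : (Int.gcd (dupNum m n) (dupDen m n)) = g at *
  have e1 : |dupNum m n| = g * |dupNum m n / (g : ℤ)| := by
    conv_lhs => rw [← Int.mul_ediv_cancel' (hgg ▸ Int.gcd_dvd_left _ _ : (g : ℤ) ∣ dupNum m n)]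
    rw [abs_mul, Nat.abs_cast]
  have e2 : |dupDen m n| = g * |dupDen m n / (g : ℤ)| := by
    conv_lhs => rw [← Int.mul_ediv_cancel' (hgg ▸ Int.gcd_dvd_right _ _ : (g : ℤ) ∣ dupDen m n)]
    rw [abs_mul, Nat.abs_cast]
  rw [e1, e2, ← mul_max_of_nonneg _ _ (by positivity)] at hu hl
  generalize max |dupNum m n / (g : ℤ)| |dupDen m n / (g : ℤ)| = M' at *
  generalize max |m| |n| = M at *
  have hg' : (0 : ℤ) < g := by exact_mod_cast hg
  have hd0 : (0 : ℤ) < discE₁ := by norm_num [discE₁]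
  have u1 : M' ≤ 2 ^ 496 * M ^ 4 := by nlinarith
  have l1 : M ^ 4 ≤ 2 ^ 496 * M' := by
    refine le_of_mul_le_mul_left (hl.trans ?_) hd0
    calc (2 : ℤ) ^ 496 * (g * M') = g * (2 ^ 496 * M') := by ring
      _ ≤ discE₁ * (2 ^ 496 * M') := mul_le_mul_of_nonneg_right hgd (by positivity)
  have hpR : (0 : ℝ) < M := by exact_mod_cast hp
  have hpR' : (0 : ℝ) < M' := by exact_mod_cast hp'
  have u2 : Real.log M' ≤ 496 * Real.log 2 + 4 * Real.log M := by
    have := Real.log_le_log hpR' (show (M' : ℝ) ≤ 2 ^ 496 * (M : ℝ) ^ 4 by exact_mod_cast u1)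
    rwa [Real.log_mul (by positivity) (by positivity), Real.log_pow, Real.log_pow] at this
  have l2 : 4 * Real.log M ≤ 496 * Real.log 2 + Real.log M' := by
    have := Real.log_le_log (by positivity)
      (show (M : ℝ) ^ 4 ≤ 2 ^ 496 * (M' : ℝ) by exact_mod_cast l1)
    rwa [Real.log_mul (by positivity) (by positivity), Real.log_pow, Real.log_pow] at this
  rw [abs_le]
  constructor <;> linarith

theorem IsCanonicalHeight.two_pow_nsmul {W : WeierstrassCurve ℚ} [W.IsElliptic]
    {H : W.toAffine.Point → ℝ} (hH : IsCanonicalHeight H) (P : W.toAffine.Point) (n : ℕ) :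
    H ((2 ^ n : ℕ) • P) = 4 ^ n * H P := by
  induction n with
  | zero => simp
  | succ n ih =>
    have := hH.parallelogram ((2 ^ n : ℕ) • P) ((2 ^ n : ℕ) • P)
    rw [sub_self, hH.zero, ← two_nsmul, smul_smul, ← pow_succ'] at this
    rw [pow_succ (4 : ℝ)]
    linarith

theorem abs_canonicalHeight_sub_le {H : E₁.toAffine.Point → ℝ} (hH : IsCanonicalHeight H)
    (P : E₁.toAffine.Point) : |H P - naiveHeight P| ≤ 496 * Real.log 2 := by
  have hC := abs_naiveHeight_dup_le
  have h0 : (0 : ℝ) ≤ 496 * Real.log 2 := by positivity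
  have h := dist_le_of_le_geometric_of_tendsto₀ (1 / 4) (496 * Real.log 2 / 4) (by norm_num) ?_ (hH P)
  · rw [dist_comm, Real.dist_eq] at h
    simp only [pow_zero, one_smul, div_one] at h
    rw [show 496 * Real.log 2 / 4 / (1 - 1 / 4) = 496 * Real.log 2 / 3 by ring] at h
    linarith
  · intro n
    have h := hC ((2 ^ n : ℕ) • P)
    rw [← two_nsmul, smul_smul, ← pow_succ'] at h
    rw [Real.dist_eq, abs_sub_comm, pow_succ (4 : ℝ) n, div_sub_div _ _ (by positivity)
      (by positivity), abs_div, abs_of_pos (a := (4 : ℝ) ^ n * 4 * 4 ^ n) (by positivity),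
      div_le_iff₀ (by positivity)]
    have e : naiveHeight ((2 ^ (n + 1) : ℕ) • P) * 4 ^ n
        - 4 ^ n * 4 * naiveHeight ((2 ^ n : ℕ) • P) = 4 ^ n *
          (naiveHeight ((2 ^ (n + 1) : ℕ) • P) - 4 * naiveHeight ((2 ^ n : ℕ) • P)) := by ring
    rw [e, abs_mul, abs_of_pos (by positivity)]
    refine (mul_le_mul_of_nonneg_left h (by positivity)).trans (le_of_eq ?_)
    rw [one_div, inv_pow]
    field_simp

/-! ### Verified evaluation of heights -/

/-- Application of a function to an integer, with the integer evaluated first. -/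
def strictInt {α : Type} (z : ℤ) (f : ℤ → α) : α :=
  match z with
  | .ofNat 0 => f 0
  | .ofNat (n + 1) => f (.ofNat (n + 1))
  | .negSucc 0 => f (.negSucc 0)
  | .negSucc (n + 1) => f (.negSucc (n + 1))

theorem strictInt_eq {α : Type} (z : ℤ) (f : ℤ → α) : strictInt z f = f z := by
  rcases z with (_ | n) | (_ | n) <;> rfl

/-- Application of a function to a natural number, with the number evaluated first. -/
def strictNat {α : Type} (n : ℕ) (f : ℕ → α) : α :=
  match n with
  | 0 => f 0
  | n + 1 => f (n + 1)

theorem strictNat_eq {α : Type} (n : ℕ) (f : ℕ → α) : strictNat n f = f n := by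
  cases n <;> rfl

/-- The binary logarithm of `n < 2 ^ 2 ^ k`. -/
def binLog (k : ℕ) : ℕ → ℕ :=
  Nat.rec (fun _ => 0) (fun k ih n => bif Nat.ble (Nat.pow 2 (Nat.pow 2 k)) n then
    strictNat (n / Nat.pow 2 (Nat.pow 2 k)) fun m => Nat.pow 2 k + ih m else ih n) k

/-- Evaluation of `dupNum`. -/
def evalNum (m n : ℤ) : ℤ :=
  m * m * (m * m) + 715835423856213676350101563730 * (m * m * (n * n)) + -70326454493372594302079938304145093648093800 * (m * n * (n * n)) +
    128105088511851307190732736061349272392917714044094636925125 * (n * n * (n * n))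

/-- Evaluation of `dupDen`. -/
def evalDen (m n : ℤ) : ℤ :=
  4 * (m * m * (m * n)) + -4 * (m * m * (n * n)) + -1431670847712427352700203127460 * (m * n * (n * n)) +
    35163227246686297151039969152072546824046900 * (n * n * (n * n))

theorem evalNum_eq (m n : ℤ) : evalNum m n = dupNum m n := by
  simp only [evalNum, dupNum, quartic, Int.cast_id]
  ring

theorem evalDen_eq (m n : ℤ) : evalDen m n = dupDen m n := by
  simp only [evalDen, dupDen, quartic, Int.cast_id]
  ring

/-- A bound for the error of `dupNum m n` for `|m|, |n|` at most `X`, `Y`, known up to `e`, `d`. -/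
def errNum (X Y e d : ℤ) : ℤ :=
  4 * (X * X * (X * e)) + 715835423856213676350101563730 * (2 * (X * Y * (Y * e)) + 2 * (X * X * (Y * d))) +
    70326454493372594302079938304145093648093800 * (Y * Y * (Y * e) + 3 * (X * Y * (Y * d))) + 128105088511851307190732736061349272392917714044094636925125 * (4 * (Y * Y * (Y * d)))

/-- A bound for the error of `dupDen m n` for `|m|, |n|` at most `X`, `Y`, known up to `e`, `d`. -/
def errDen (X Y e d : ℤ) : ℤ :=
  4 * (3 * (X * X * (Y * e)) + X * X * (X * d)) +
    4 * (2 * (X * Y * (Y * e)) + 2 * (X * X * (Y * d))) +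
    1431670847712427352700203127460 * (Y * Y * (Y * e) + 3 * (X * Y * (Y * d))) + 35163227246686297151039969152072546824046900 * (4 * (Y * Y * (Y * d)))

theorem abs_monomial_sub_le {X Y e d m n x y : ℤ} (i j : ℕ) (hm : |m| ≤ X) (hx : |x| ≤ X)
    (hn : |n| ≤ Y) (hy : |y| ≤ Y) (he : |m - x| ≤ e) (hd : |n - y| ≤ d) :
    |m ^ i * n ^ j - x ^ i * y ^ j|
      ≤ i * X ^ (i - 1) * Y ^ j * e + j * X ^ i * Y ^ (j - 1) * d := by
  have hX : 0 ≤ X := (abs_nonneg m).trans hm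
  have hY : 0 ≤ Y := (abs_nonneg n).trans hn
  have he0 : 0 ≤ e := (abs_nonneg _).trans he
  have hd0 : 0 ≤ d := (abs_nonneg _).trans hd
  have h1 : |m ^ i - x ^ i| ≤ e * i * X ^ (i - 1) :=
    (abs_pow_sub_pow_le m x i).trans (by gcongr; exact max_le hm hx)
  have h2 : |n ^ j - y ^ j| ≤ d * j * Y ^ (j - 1) :=
    (abs_pow_sub_pow_le n y j).trans (by gcongr; exact max_le hn hy)
  calc |m ^ i * n ^ j - x ^ i * y ^ j|
      = |(m ^ i - x ^ i) * n ^ j + x ^ i * (n ^ j - y ^ j)| := by ring_nf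
    _ ≤ |m ^ i - x ^ i| * |n| ^ j + |x| ^ i * |n ^ j - y ^ j| := by
        rw [← abs_pow, ← abs_pow, ← abs_mul, ← abs_mul]; exact abs_add_le _ _
    _ ≤ (e * i * X ^ (i - 1)) * Y ^ j + X ^ i * (d * j * Y ^ (j - 1)) := by gcongr
    _ = _ := by ring

theorem abs_dup_sub_le {X Y e d m n x y : ℤ} (hm : |m| ≤ X) (hx : |x| ≤ X)
    (hn : |n| ≤ Y) (hy : |y| ≤ Y) (he : |m - x| ≤ e) (hd : |n - y| ≤ d) :
    |dupNum m n - dupNum x y| ≤ errNum X Y e d ∧ |dupDen m n - dupDen x y| ≤ errDen X Y e d := by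
  have h := fun i j => abs_le.mp (abs_monomial_sub_le i j hm hx hn hy he hd)
  have h40 := h 4 0
  have h31 := h 3 1
  have h22 := h 2 2
  have h13 := h 1 3
  have h04 := h 0 4
  simp only [pow_zero, pow_one, mul_one, one_mul, Nat.cast_zero, Nat.cast_one, Nat.cast_ofNat,
    zero_mul, add_zero, zero_add, Nat.reduceSub] at h40 h31 h22 h13 h04
  simp only [dupNum, dupDen, quartic, Int.cast_id, errNum, errDen]
  rw [abs_le, abs_le]
  refine ⟨⟨?_, ?_⟩, ?_, ?_⟩
  · linarith [h40.1, h22.1, h13.2, h04.1]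
  · linarith [h40.2, h22.2, h13.1, h04.2]
  · linarith [h31.1, h22.2, h13.2, h04.1]
  · linarith [h31.2, h22.1, h13.1, h04.2]

/-- Partial information on coprime homogeneous coordinates `(m, n)` of the first coordinate of a
point: residues modulo `M`, and approximations of `m / 2 ^ A`, `n / 2 ^ A` up to `e`, `d`. -/
structure State where
  A : ℕ
  M : ℤ
  m : ℤ
  n : ℤ
  x : ℤ
  y : ℤ
  e : ℤ
  d : ℤ

/-- The state describes the point. -/
def State.Describes (s : State) (P : E₁.toAffine.Point) : Prop :=
  ∃ m n, IsRep P m n ∧ s.M ∣ m - s.m ∧ s.M ∣ n - s.n ∧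
    |m - s.x * 2 ^ s.A| ≤ s.e * 2 ^ s.A ∧ |n - s.y * 2 ^ s.A| ≤ s.d * 2 ^ s.A

/-- Duplication of a state, followed by the function `k`. -/
def State.dup {α : Type} (s : State) (k : State → α) : α :=
  strictInt (evalNum s.m s.n % s.M) fun f =>
  strictInt (evalDen s.m s.n % s.M) fun h =>
  strictInt (Int.gcd (Int.gcd f h) discE₁) fun g =>
  strictInt (s.M / g) fun M =>
  strictInt (f / g % M) fun m =>
  strictInt (h / g % M) fun n =>
  strictInt (evalNum s.x s.y) fun a =>
  strictInt (evalDen s.x s.y) fun b =>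
  strictInt (s.x.natAbs + s.e) fun X =>
  strictInt (s.y.natAbs + s.d) fun Y =>
  strictNat (a.natAbs + b.natAbs) fun c =>
  strictNat (binLog 13 c - 1000) fun L =>
  strictInt (g * (Nat.pow 2 L : ℕ)) fun q =>
  strictInt (a / q) fun x =>
  strictInt (b / q) fun y =>
  strictInt (errNum X Y s.e s.d / q + 2) fun e =>
  strictInt (errDen X Y s.e s.d / q + 2) fun d =>
  strictNat (4 * s.A + L) fun A => k ⟨A, M, m, n, x, y, e, d⟩

/-- Iterated duplication of a state, followed by a comparison. -/
def State.run (A : ℕ) (k : ℕ) : State → Bool :=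
  Nat.rec (fun s => Nat.beq s.A A && (decide (s.e < s.x.natAbs) || decide (s.d < s.y.natAbs)) &&
      decide (s.x.natAbs + s.e ≤ (Nat.pow 2 1100 : ℕ)) &&
      decide (s.y.natAbs + s.d ≤ (Nat.pow 2 1100 : ℕ)))
    (fun _ ih s => decide (s.M % discE₁ = 0) && s.dup ih) k

theorem dvd_quartic_sub {M m n x y : ℤ} (c₄ c₃ c₂ c₁ c₀ : ℤ) (hm : M ∣ m - x) (hn : M ∣ n - y) :
    M ∣ quartic c₄ c₃ c₂ c₁ c₀ m n - quartic c₄ c₃ c₂ c₁ c₀ x y := by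
  have hm' : m ≡ x [ZMOD M] := (Int.modEq_iff_dvd.mpr hm).symm
  have hn' : n ≡ y [ZMOD M] := (Int.modEq_iff_dvd.mpr hn).symm
  refine Int.modEq_iff_dvd.mp (Int.ModEq.symm ?_)
  simp only [quartic]
  gcongr

theorem gcd_gcd_eq {F H f h D M : ℤ} (hF : M ∣ F - f) (hH : M ∣ H - h) (hD : D ∣ M)
    (hg : (Int.gcd F H : ℤ) ∣ D) : Int.gcd (Int.gcd f h) D = Int.gcd F H := by
  refine Nat.dvd_antisymm ?_ ?_
  · have h1 : (Int.gcd (Int.gcd f h) D : ℤ) ∣ Int.gcd f h := Int.gcd_dvd_left _ _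
    have h2 : (Int.gcd (Int.gcd f h) D : ℤ) ∣ M := (Int.gcd_dvd_right _ _).trans hD
    refine Int.dvd_gcd ?_ ?_
    · exact (dvd_sub_left (h1.trans (Int.gcd_dvd_left _ _))).mp (h2.trans hF)
    · exact (dvd_sub_left (h1.trans (Int.gcd_dvd_right _ _))).mp (h2.trans hH)
  · have h2 := hg.trans hD
    refine Int.dvd_gcd ?_ hg
    refine Int.natCast_dvd_natCast.mpr (Int.dvd_gcd ?_ ?_)
    · exact (dvd_sub_right (Int.gcd_dvd_left _ _)).mp (h2.trans hF)
    · exact (dvd_sub_right (Int.gcd_dvd_right _ _)).mp (h2.trans hH)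

theorem dvd_div_sub_mod {F f g M : ℤ} (hg : g ≠ 0) (hF : g ∣ F) (hf : g ∣ f) (hM : g ∣ M)
    (h : M ∣ F - f) : M / g ∣ F / g - f / g % (M / g) := by
  obtain ⟨F', rfl⟩ := hF
  obtain ⟨f', rfl⟩ := hf
  obtain ⟨M', rfl⟩ := hM
  rw [Int.mul_ediv_cancel_left _ hg, Int.mul_ediv_cancel_left _ hg,
    Int.mul_ediv_cancel_left _ hg]
  rw [← mul_sub, mul_dvd_mul_iff_left hg] at h
  have h2 : M' ∣ f' - f' % M' := Int.dvd_self_sub_emod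
  have := dvd_add h h2
  rwa [sub_add_sub_cancel] at this

theorem abs_div_sub_le {F g s a E L : ℤ} (hg : 0 < g) (hF : g ∣ F) (hL : 0 < L)
    (hs : 0 ≤ s) (h : |F - a * s| ≤ E * s) :
    |F / g - a / (g * L) * (s * L)| ≤ (E / (g * L) + 2) * (s * L) := by
  obtain ⟨F', rfl⟩ := hF
  rw [Int.mul_ediv_cancel_left _ hg.ne']
  have hq : 0 < g * L := mul_pos hg hL
  have h1 := Int.emod_add_mul_ediv a (g * L)
  have h2 := Int.emod_nonneg a hq.ne'
  have h3 := Int.emod_lt_of_pos a hq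
  have h4 := Int.emod_add_mul_ediv E (g * L)
  have h6 := Int.emod_lt_of_pos E hq
  refine le_of_mul_le_mul_left ?_ hg
  generalize a / (g * L) = a' at *
  generalize E / (g * L) = E' at *
  generalize a % (g * L) = r at *
  generalize E % (g * L) = t at *
  rw [← abs_of_pos hg, ← abs_mul, abs_of_pos hg]
  have e1 : g * (F' - a' * (s * L)) = (g * F' - a * s) + r * s := by
    rw [← h1]; ring
  have hr : |r * s| ≤ g * L * s := by
    rw [abs_mul, abs_of_nonneg h2, abs_of_nonneg hs]; gcongr
  have hE : E * s ≤ (E' + 1) * (g * L) * s := by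
    gcongr
    rw [← h4]; linarith
  rw [e1]
  calc _ ≤ _ := abs_add_le _ _
    _ ≤ E * s + g * L * s := add_le_add h hr
    _ ≤ (E' + 1) * (g * L) * s + g * L * s := by linarith
    _ = _ := by ring

theorem State.Describes.dup {s : State} {P : E₁.toAffine.Point} (hs : s.Describes P)
    (hM : discE₁ ∣ s.M) : ∃ s' : State, s'.Describes (P + P) ∧
      ∀ {α : Type} (k : State → α), s.dup k = k s' := by
  obtain ⟨m, n, hrep, hm, hn, hx, hy⟩ := hs
  simp only [State.dup, strictInt_eq, strictNat_eq, evalNum_eq, evalDen_eq]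
  refine ⟨_, ?_, fun k => rfl⟩
  have hg := gcd_dup_pos hrep.1
  have hgd := gcd_dup_dvd hrep.1
  have hF : s.M ∣ dupNum m n - dupNum s.m s.n % s.M := by
    have h1 : s.M ∣ dupNum m n - dupNum s.m s.n := dvd_quartic_sub _ _ _ _ _ hm hn
    have := dvd_add h1 (Int.dvd_self_sub_emod : s.M ∣ dupNum s.m s.n - dupNum s.m s.n % s.M)
    rwa [sub_add_sub_cancel] at this
  have hH : s.M ∣ dupDen m n - dupDen s.m s.n % s.M := by
    have h1 : s.M ∣ dupDen m n - dupDen s.m s.n := dvd_quartic_sub _ _ _ _ _ hm hn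
    have := dvd_add h1 (Int.dvd_self_sub_emod : s.M ∣ dupDen s.m s.n - dupDen s.m s.n % s.M)
    rwa [sub_add_sub_cancel] at this
  rw [gcd_gcd_eq hF hH hM hgd]
  have hgM := hgd.trans hM
  have hgF : (Int.gcd (dupNum m n) (dupDen m n) : ℤ) ∣ dupNum m n := Int.gcd_dvd_left _ _
  have hgH : (Int.gcd (dupNum m n) (dupDen m n) : ℤ) ∣ dupDen m n := Int.gcd_dvd_right _ _
  have hg' : (0 : ℤ) < Int.gcd (dupNum m n) (dupDen m n) := by exact_mod_cast hg
  have hxb : ∀ {m x e : ℤ}, |m - x * 2 ^ s.A| ≤ e * 2 ^ s.A →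
      |m| ≤ (x.natAbs + e) * 2 ^ s.A ∧ |x * 2 ^ s.A| ≤ (x.natAbs + e) * 2 ^ s.A := by
    intro m x e h
    rw [Int.natCast_natAbs]
    have h0 := (abs_nonneg _).trans h
    have h1 : |x * 2 ^ s.A| = |x| * 2 ^ s.A := by rw [abs_mul, abs_pow, abs_two]
    have h2 := abs_sub_abs_le_abs_sub m (x * 2 ^ s.A)
    constructor <;> linarith
  obtain ⟨b1, b2⟩ := hxb hx
  obtain ⟨b3, b4⟩ := hxb hy
  obtain ⟨e1, e2⟩ := abs_dup_sub_le b1 b2 b3 b4 hx hy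
  have q1 : dupNum (s.x * 2 ^ s.A) (s.y * 2 ^ s.A) = dupNum s.x s.y * (2 ^ s.A) ^ 4 := by
    rw [mul_comm s.x, mul_comm s.y, dupNum, quartic_smul, mul_comm]; rfl
  have q2 : dupDen (s.x * 2 ^ s.A) (s.y * 2 ^ s.A) = dupDen s.x s.y * (2 ^ s.A) ^ 4 := by
    rw [mul_comm s.x, mul_comm s.y, dupDen, quartic_smul, mul_comm]; rfl
  have q3 : ∀ X Y e d t : ℤ, errNum (X * t) (Y * t) (e * t) (d * t) = errNum X Y e d * t ^ 4 := by
    intro X Y e d t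
    simp only [errNum]; ring
  have q4 : ∀ X Y e d t : ℤ, errDen (X * t) (Y * t) (e * t) (d * t) = errDen X Y e d * t ^ 4 := by
    intro X Y e d t
    simp only [errDen]; ring
  rw [q1, q3] at e1
  rw [q2, q4] at e2
  have hpow : ∀ L : ℕ, (2 : ℤ) ^ (4 * s.A + L) = (2 ^ s.A) ^ 4 * (Nat.pow 2 L : ℕ) := by
    intro L
    rw [pow_add, mul_comm 4, pow_mul, Nat.pow_eq]
    push_cast
    rfl
  refine ⟨_, _, hrep.dup, dvd_div_sub_mod hg'.ne' hgF ?_ hgM hF,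
    dvd_div_sub_mod hg'.ne' hgH ?_ hgM hH, ?_, ?_⟩
  · exact (dvd_sub_right hgF).mp (hgM.trans hF)
  · exact (dvd_sub_right hgH).mp (hgM.trans hH)
  · rw [hpow]
    exact abs_div_sub_le hg' hgF (by exact_mod_cast Nat.pow_pos two_pos) (by positivity) e1
  · rw [hpow]
    exact abs_div_sub_le hg' hgH (by exact_mod_cast Nat.pow_pos two_pos) (by positivity) e2

set_option exponentiation.threshold 1200 in
theorem State.Describes.of_run {A k : ℕ} {s : State} {P : E₁.toAffine.Point}
    (hs : s.Describes P) (h : s.run A k = true) :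
    |naiveHeight ((2 ^ k : ℕ) • P) - A * Real.log 2| ≤ 1100 * Real.log 2 := by
  induction k generalizing s P with
  | zero =>
    have h' : (Nat.beq s.A A && (decide (s.e < s.x.natAbs) || decide (s.d < s.y.natAbs)) &&
      decide (s.x.natAbs + s.e ≤ (Nat.pow 2 1100 : ℕ)) &&
      decide (s.y.natAbs + s.d ≤ (Nat.pow 2 1100 : ℕ))) = true := h
    rw [Bool.and_eq_true, Bool.and_eq_true, Bool.and_eq_true, Bool.or_eq_true, decide_eq_true_eq,
      decide_eq_true_eq, decide_eq_true_eq, decide_eq_true_eq] at h'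
    obtain ⟨⟨⟨hA, h1⟩, h2⟩, h3⟩ := h'
    obtain rfl := Nat.eq_of_beq_eq_true hA
    obtain ⟨m, n, hrep, -, -, hx, hy⟩ := hs
    rw [pow_zero, one_smul, hrep.naiveHeight_eq]
    have hpos : (0 : ℤ) < 2 ^ s.A := by positivity
    have low : ∀ {m x e : ℤ}, |m - x * 2 ^ s.A| ≤ e * 2 ^ s.A → e < x.natAbs → 2 ^ s.A ≤ |m| := by
      intro m x e h h1
      rw [Int.natCast_natAbs] at h1
      have h2 : |x * 2 ^ s.A| = |x| * 2 ^ s.A := by rw [abs_mul, abs_pow, abs_two]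
      have h3 := abs_sub_abs_le_abs_sub (x * 2 ^ s.A) m
      rw [abs_sub_comm] at h3
      nlinarith
    have up : ∀ {m x e : ℤ}, |m - x * 2 ^ s.A| ≤ e * 2 ^ s.A → x.natAbs + e ≤ (Nat.pow 2 1100 : ℕ) →
        |m| ≤ 2 ^ 1100 * 2 ^ s.A := by
      intro m x e h h1
      rw [Int.natCast_natAbs, Nat.pow_eq, Nat.cast_pow, Nat.cast_ofNat] at h1
      have h2 : |x * 2 ^ s.A| = |x| * 2 ^ s.A := by rw [abs_mul, abs_pow, abs_two]
      have h3 := abs_sub_abs_le_abs_sub m (x * 2 ^ s.A)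
      have h4 := mul_le_mul_of_nonneg_right h1 hpos.le
      linarith
    have hl : 2 ^ s.A ≤ max |m| |n| := by
      rcases h1 with h1 | h1
      · exact (low hx h1).trans (le_max_left _ _)
      · exact (low hy h1).trans (le_max_right _ _)
    have hu : max |m| |n| ≤ 2 ^ 1100 * 2 ^ s.A := max_le (up hx h2) (up hy h3)
    have hp := hrep.max_pos
    generalize max |m| |n| = M at *
    have hpR : (0 : ℝ) < M := by exact_mod_cast hp
    have l1 := Real.log_le_log (by positivity) (show (2 : ℝ) ^ s.A ≤ M by exact_mod_cast hl)
    have u1 := Real.log_le_log hpR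
      (show (M : ℝ) ≤ 2 ^ 1100 * 2 ^ s.A by exact_mod_cast hu)
    rw [Real.log_mul (by positivity) (by positivity), Real.log_pow, Real.log_pow] at u1
    rw [Real.log_pow] at l1
    have h0 : (0 : ℝ) ≤ 1100 * Real.log 2 := by positivity
    push_cast at u1
    rw [abs_le]
    constructor <;> linarith
  | succ k ih =>
    have h' : (decide (s.M % discE₁ = 0) && s.dup (State.run A k)) = true := h
    rw [Bool.and_eq_true, decide_eq_true_eq] at h'
    obtain ⟨s', hs', hk⟩ := hs.dup (Int.dvd_of_emod_eq_zero h'.1)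
    have := ih hs' ((hk _).symm.trans h'.2)
    rwa [← two_nsmul, smul_smul, ← pow_succ] at this

/-- The initial state for a point with first coordinate `x`. -/
def State.init (x : ℚ) : State :=
  ⟨0, discE₁ * (Nat.pow 10626 10 * Nat.pow 5 200 : ℕ), x.num, x.den, x.num, x.den, 0, 0⟩

theorem abs_height_sub_le {H : E₁.toAffine.Point → ℝ} (hH : IsCanonicalHeight H) {x y : ℚ}
    (h : E₁.toAffine.Nonsingular x y) {A : ℕ} (hA : (State.init x).run A 48 = true) :
    |H (.some x y h) / Real.log 2 - A / 4 ^ 48| ≤ 1600 / 4 ^ 48 := by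
  have hd : (State.init x).Describes (.some x y h) := by
    refine ⟨x.num, x.den, isRep_some h, ?_, ?_, ?_, ?_⟩ <;> simp [State.init]
  have h1 := hd.of_run hA
  have h2 := abs_canonicalHeight_sub_le hH ((2 ^ 48 : ℕ) • .some x y h)
  rw [hH.two_pow_nsmul] at h2
  have hl : 0 < Real.log 2 := Real.log_pos one_lt_two
  have h3 : |4 ^ 48 * H (.some x y h) - A * Real.log 2| ≤ 1600 * Real.log 2 := by
    have := (abs_add_le _ _).trans (add_le_add h2 h1)
    rw [sub_add_sub_cancel] at this
    linarith
  have e : H (.some x y h) / Real.log 2 - A / 4 ^ 48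
      = (4 ^ 48 * H (.some x y h) - A * Real.log 2) / (4 ^ 48 * Real.log 2) := by
    field_simp
  rw [e, abs_div, abs_of_pos (a := 4 ^ 48 * Real.log 2) (by positivity),
    div_le_div_iff₀ (by positivity) (by positivity)]
  calc _ ≤ 1600 * Real.log 2 * 4 ^ 48 := by gcongr
    _ = _ := by ring

/-! ### The eight points on `E₁` and the heights of their pairwise sums -/

/-- The first coordinates of the points `ptsE₁`. -/
def xs : Fin 8 → ℚ :=
  ![24538897087717, -13799702662964101415 / 82944,
    -13080188731586725415 / 82944, 30522292485524019385 / 5184,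
    32753328095455405945 / 5184, 26593017227980180185 / 1024,
    27633358692754681305 / 1024, 25987686745190807005 / 324]

/-- The second coordinates of the points `ptsE₁`. -/
def ys : Fin 8 → ℚ :=
  ![150589484993010033162, -190704903674371079831395617565 / 23887872,
    187047177489229322668056753565 / 23887872, -167757340555696350468776612365 / 373248,
    186610059494075442941809022125 / 373248, -137099623177818611133088507165 / 32768,
    145225826427944291785552681885 / 32768, -132476656106169003459698452585 / 5832]

theorem changePoint_some_eq {x y x' y' : ℚ} {h : (model (1 : ℚ)).toAffine.Nonsingular x y}
    (hx : (x - changeToE₁.r) / changeToE₁.u ^ 2 = x')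
    (hy : (y - changeToE₁.s * (x - changeToE₁.r) - changeToE₁.t) / changeToE₁.u ^ 3 = y') :
    ∃ h', changePoint changeToE₁ changeToE₁_smul (.some x y h) = .some x' y' h' := by
  subst hx hy
  exact ⟨_, rfl⟩

theorem ptsE₁_eq (i : Fin 8) : ∃ h, ptsE₁ i = .some (xs i) (ys i) h := by
  obtain ⟨-, -, hA2, hA3, -⟩ := coeffs_coefA
  obtain ⟨-, -, hB2, hB3, hB4⟩ := coeffs_coefB
  obtain ⟨-, -, hC2, hC3, -⟩ := coeffs_coefC
  have hB : ∀ x : ℚ, aeval x coefB = -5852770213 / 382205952 * x ^ 4 + 89071 / 36864 * x ^ 3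
      + -89233 / 1152 * x ^ 2 + -9 / 2 * x + 144 := by
    intro x
    simp [coefB, -map_div₀, -map_neg]
  refine Fin.cases ?_ (fun j => ?_) i
  · refine changePoint_some_eq ?_ ?_ <;>
    simp only [cubicX, cubicY, leadRoot, quarticCoeff, changeToE₁, Units.val_mk0, eq_ratCast,
      Rat.cast_id, hA2, hA3, hB2, hB3, hB4, hC2, hC3, xs, ys,
      Matrix.cons_val_zero] <;>
    norm_num
  · refine changePoint_some_eq ?_ ?_ <;>
    simp only [cubicX, cubicY, leadRoot, quarticCoeff, ordinate, changeToE₁, Units.val_mk0,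
      eq_ratCast, Rat.cast_id, hB, hA2, hA3, hB2, hB3, hB4, hC2, hC3, xs, ys, Matrix.cons_val_succ] <;>
    fin_cases j <;>
    simp only [roots, Fin.mk_zero, Fin.mk_one, Fin.reduceFinMk, Fin.isValue, Matrix.cons_val] <;>
    norm_num

/-- The first coordinate of `ptsE₁ i` if `i = j`, and of `ptsE₁ i + ptsE₁ j` otherwise. -/
def sumX (i j : Fin 8) : ℚ :=
  if i = j then xs i
  else ((ys i - ys j) / (xs i - xs j)) ^ 2 + 1 - xs i - xs j

theorem ptsE₁_add (i j : Fin 8) (hij : i ≠ j) :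
    ∃ y h, ptsE₁ i + ptsE₁ j = .some (sumX i j) y h := by
  have hx : xs i ≠ xs j := by
    revert i j
    decide +kernel
  obtain ⟨hi, ei⟩ := ptsE₁_eq i
  obtain ⟨hj, ej⟩ := ptsE₁_eq j
  rw [ei, ej, Point.add_of_X_ne hx]
  have e : E₁.toAffine.addX (xs i) (xs j) (E₁.toAffine.slope (xs i) (xs j) (ys i) (ys j))
      = sumX i j := by
    rw [slope_of_X_ne hx, addX, sumX, if_neg hij]
    simp only [E₁]
    ring
  have key : ∀ {x y : ℚ} (h : E₁.toAffine.Nonsingular x y), x = sumX i j →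
      ∃ y' h', Point.some x y h = .some (sumX i j) y' h' := by
    rintro x y h rfl
    exact ⟨_, _, rfl⟩
  exact key _ e

/-- Approximations of `4 ^ 48` times the heights of the points `ptsE₁ i` and
`ptsE₁ i + ptsE₁ j`, in units of `log 2`. -/
def hints : Fin 8 → Fin 8 → ℕ :=
  ![![3664240245797674003372146595990, 13446210999661844517595774423617,
      13570094592518382365211144362653, 13766986014862455346137416432796,
      13514593818256806567493885574272, 13483994374460949732941261927933,
      13313867955127275963371909223056, 13298905227010348287562495543386],
    ![13446210999661844517595774423617, 4725278548147467792560300769074,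
      14188675932147054393275327162468, 14859396383591827759049470290199,
      14671630080404492158768477126107, 14253546898199054612029540048776,
      13764449213319243487171392007889, 13799316487875579656853461581366],
    ![13570094592518382365211144362653, 14188675932147054393275327162468,
      4861672671750086387982156160045, 14587852135490120062589692354513,
      14636668843710930368708181202870, 14335797210250425785283118070205,
      14134894607522057339541199197061, 14067758816988410214914685902431],
    ![13766986014862455346137416432796, 14859396383591827759049470290199,
      14587852135490120062589692354513, 4975398863969050013029862789716,
      14653581629619853079748612693837, 14471731469917758781118524051554,
      14570962371277976389383835760476, 14554047911982067653918816432433],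
    ![13514593818256806567493885574272, 14671630080404492158768477126107,
      14636668843710930368708181202870, 14653581629619853079748612693837,
      4714246134434673270591838716122, 14156862930363692572031446520137,
      14287056597023120261957169026976, 14287067427492277753592393347670],
    ![13483994374460949732941261927933, 14253546898199054612029540048776,
      14335797210250425785283118070205, 14471731469917758781118524051554,
      14156862930363692572031446520137, 4707622336491891169525651414156,
      13803628044627789577679041231092, 13791256900493597558077198662708],
    ![13313867955127275963371909223056, 13764449213319243487171392007889,
      14134894607522057339541199197061, 14570962371277976389383835760476,
      14287056597023120261957169026976, 13803628044627789577679041231092,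
      4532769085985425618268416752660, 13366472472684869036996524563672],
    ![13298905227010348287562495543386, 13799316487875579656853461581366,
      14067758816988410214914685902431, 14554047911982067653918816432433,
      14287067427492277753592393347670, 13791256900493597558077198662708,
      13366472472684869036996524563672, 4525019890842774083263928640038]]

theorem run_sumX (i j : Fin 8) : (State.init (sumX i j)).run (hints i j) 48 = true := by
  have h : ∀ i j : Fin 8, i ≤ j → (State.init (sumX i j)).run (hints i j) 48 = true := by
    decide +kernel
  have hs : ∀ i j : Fin 8, sumX i j = sumX j i ∧ hints i j = hints j i := by
    decide +kernel
  rcases le_total i j with hij | hij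
  · exact h i j hij
  · rw [(hs i j).1, (hs i j).2]
    exact h j i hij

/-! ### The determinant of the height matrix -/

theorem abs_prod_sub_prod_le {ι : Type*} (s : Finset ι) {f g : ι → ℝ} {c ε : ℝ} (hc : 1 ≤ c)
    (hf : ∀ i, |f i| ≤ c) (hg : ∀ i, |g i| ≤ c) (hfg : ∀ i, |f i - g i| ≤ ε) :
    |∏ i ∈ s, f i - ∏ i ∈ s, g i| ≤ s.card * c ^ s.card * ε := by
  classical
  induction s using Finset.induction_on with
  | empty => simp
  | insert a s ha ih =>
    have hε : 0 ≤ ε := (abs_nonneg _).trans (hfg a)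
    have hp : |∏ i ∈ s, f i| ≤ c ^ s.card := by
      rw [Finset.abs_prod, ← Finset.prod_const]
      exact Finset.prod_le_prod (fun i _ => abs_nonneg _) fun i _ => hf i
    rw [Finset.prod_insert ha, Finset.prod_insert ha, Finset.card_insert_of_notMem ha]
    calc |f a * ∏ i ∈ s, f i - g a * ∏ i ∈ s, g i|
        = |(f a - g a) * ∏ i ∈ s, f i + g a * (∏ i ∈ s, f i - ∏ i ∈ s, g i)| := by ring_nf
      _ ≤ |f a - g a| * |∏ i ∈ s, f i| + |g a| * |∏ i ∈ s, f i - ∏ i ∈ s, g i| := by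
          rw [← abs_mul, ← abs_mul]; exact abs_add_le _ _
      _ ≤ ε * c ^ s.card + c * (s.card * c ^ s.card * ε) := by
          gcongr
          · exact hfg a
          · exact hg a
      _ ≤ ε * (c ^ s.card * c) + c * (s.card * c ^ s.card * ε) := by
          have := le_mul_of_one_le_right (pow_nonneg (zero_le_one.trans hc) s.card) hc
          gcongr
      _ = _ := by push_cast; ring

theorem abs_det_sub_det_le {n : ℕ} {A B : Matrix (Fin n) (Fin n) ℝ} {c ε : ℝ} (hc : 1 ≤ c)
    (hA : ∀ i j, |A i j| ≤ c) (hB : ∀ i j, |B i j| ≤ c) (hAB : ∀ i j, |A i j - B i j| ≤ ε) :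
    |A.det - B.det| ≤ n.factorial * (n * c ^ n * ε) := by
  rw [Matrix.det_apply, Matrix.det_apply, ← Finset.sum_sub_distrib]
  refine (Finset.abs_sum_le_sum_abs _ _).trans ?_
  have h : ∀ σ ∈ (Finset.univ : Finset (Equiv.Perm (Fin n))),
      |Equiv.Perm.sign σ • ∏ i, A (σ i) i - Equiv.Perm.sign σ • ∏ i, B (σ i) i|
        ≤ n * c ^ n * ε := by
    intro σ _
    have := abs_prod_sub_prod_le (Finset.univ : Finset (Fin n)) hc (fun i => hA (σ i) i)
      (fun i => hB (σ i) i) (fun i => hAB (σ i) i)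
    rw [Finset.card_univ, Fintype.card_fin] at this
    rw [← smul_sub, Units.smul_def, zsmul_eq_mul, abs_mul]
    rcases Int.units_eq_one_or (Equiv.Perm.sign σ) with h | h <;> simpa [h] using this
  refine (Finset.sum_le_card_nsmul _ _ _ h).trans_eq ?_
  rw [Finset.card_univ, Fintype.card_perm, Fintype.card_fin, nsmul_eq_mul]

/-- An approximation of `2 * 4 ^ 48` times the height matrix, in units of `log 2`. -/
def approx (i j : Fin 8) : ℤ :=
  if i = j then 2 * hints i i else hints i j - hints i i - hints j j

/-- A lower triangular matrix whose product with the matrix `approx` is upper triangular. -/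
def elim : Fin 8 → Fin 8 → ℤ :=
  ![![1,
      0,
      0,
      0,
      0,
      0,
      0,
      0],
    ![-722384600816671817380475294079,
      1046925784513621143820613313140,
      0,
      0,
      0,
      0,
      0,
      0],
    ![-24400821438108501393841623244689257158705026831187891439979467,
      -8216775621369712194317556105277568084708221061929709977037266,
      43688087251549361990172199516252113688357120612939297567199231,
      0,
      0,
      0,
      0,
      0],
    ![-56379173865219962951257881220212660835875040418940420784111643980581667304613207619730522267,
      -32108854752917131354787389654012547828647957971900590575618330720616907766126487176680108466,
      -20026502395483891905819654505253241951672591899409618868685563453399322248939344699769178444,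
      131950421979789150869053582284659020287545146814101754573815653568761700209300527271286777175,
      0,
      0,
      0,
      0],
    ![-86478693750710322603135496687252975694301558974643918729645472173323377172627336217464256670946475106167241442649428872631,
      -54675410448461799425190780548480206550288605532178450270057862666076265217477458205365690412632544408485081749232971023898,
      -46014387560450576196558457911394161023218013719135930141440556415514936626992399595695890362940932660334926525579504355932,
      -32026001303658746517214907761584615184049285196923062459735475347930725765404257962712578734657809752043501180550567121149,
      254384766459772970947098594370114317706841750130771006424158175460985635895353304367766062383460224585715682632779136645696,
      0,
      0,
      0],
    ![-471109717380252387342181838905365912248707537697896166012778820794201597546712034355735021019590112288163311264421139054262027425138031544780316943209993,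
      -171837677306904154721618015646143668647198125811295139945397591586085075700051920731465068096289249371865955386094151207794909419327291115908508181013377,
      -165742478485349132913121993239259390973010072955173847994899751129302601579397200147925055297349813071407916557007485352297489609088624859941692531535669,
      -140351969851365187101041661916337833153497016768167448055860799514743405818319177610510557661561392718627282998142267143359545665015508636097588968896405,
      -126158259702230333864123452153589068646541522178634693657895239592339422990701431287498516997280514942650724287626416523075137043011239614521715864668613,
      1276391076948990342700073310898212710527119698072370234769744043127198897177970178037067020456263779212193488896852217903383304380565327823341178905844739,
      0,
      0],
    ![-2195572220915101330495950758854503380626964599958357575378548482990756656163015661854882768886343188824352604956239918789286397428142657764580034975037367827192047386015483849049043967,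
      -274310503312233367608429641418776084017168416853414077870920138355226708322229285338622647806481956109789606775468577414224646032044305088517755147726762183249400644838461898007553321,
      -695890592185263392835099769130139112368325427637312890518644730785525514666495060804208935822103288838742133921891320258056797214410512528687612588181735865798697237796840266915912113,
      -1035376632580012765263981287076947563361852277207214655558862017730663156673142811663623794845247508527272631209569931493943124612901436772886344194196824840573495594848282477966846249,
      -1071222893033789312633915103093396248689485654209280806935714304097447083533364342016500794604635102068033996321494442099136904800027167855693561175638000725891303978416575048192915033,
      -507392682870500591028565922028850668514843047146665203314719121392093440529374768669758304455621251912001868533158398055456675797229497360498343043681991482856148680845683060267619785,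
      6721315241243893766715215064981154998511206641014938826502210581666247148072589736258695254403469788174322164785762245090494267450520125268641191152397667230503542902189984462149050782,
      0],
    ![-62378886117373773242113274596089916427495093456410151913613816979511047534469037456424785592576533074714145560654183980748690447991804765563444045214141557037312736412129750667692947017510097073489211058312339172196,
      -9693234019852840165404602466588829738084059143971838481620355962719717727439287046495065179563721853613801971480458214643234905921891382633115469501887678348540970068138988726558627215991664740472510337035772998464,
      -17750049674703993003728574673546258732708359055692406987627613663868351062061221915130295859028867628136517178021245661537165143621057628269650074294279970436395150158896235074585541599258335493069349337028908285091,
      -29193132658188395942887349495038220470671325092988769481876790271213745742383063957772589599512909542496788913610438066794872469094357570976796442144783255627419203220882744491972803758065238154758986696467783794853,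
      -31024817971179673288477908858772115852317690149911664676309875559839724031346342228554148107971538038395159251688986463477558311998007350489227485234602006524853759625039734924426292601306547934218378238434297032438,
      -14468742338001105579057646119964907343419021504634433358516675548859260893991610130154332900355769363194705927582221015921637248000889086002546707512568052550226914396646556865170715784656408039282586760246791342168,
      -1700004858381001018559192754108281587461314367355306851994835299386138310282040714983078902014401237997020172942828381684793190830983538356984132247539893433144404407340996469005794309147652119298363393389670651398,
      193239946747610151945909277529974775586573411890853545859182207092611298065148120604777087194258402227591936938814995275575274615301965999929482793422386069100809317741092451226793196150951627146494484309528540632158]]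

theorem det_approx : (Matrix.of approx).det = 925490791180514743866784288203136742207753600493276888711201887982128527660871959013033794542840120695043216918948791902651590075611068609650275669398453213894985043702872349372624738083295456404422752894785321805217656686410709705793669011401745 := by
  have h1 : ∀ i j : Fin 8, i < j → elim i j = 0 := by decide +kernel
  have h2 : ∀ i j : Fin 8, j < i → ∑ k, elim i k * approx k j = 0 := by decide +kernel
  have h3 : (∏ i, elim i i) * 925490791180514743866784288203136742207753600493276888711201887982128527660871959013033794542840120695043216918948791902651590075611068609650275669398453213894985043702872349372624738083295456404422752894785321805217656686410709705793669011401745 = ∏ i, ∑ k, elim i k * approx k i := by decide +kernel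
  have h4 : ∏ i, elim i i ≠ 0 := by decide +kernel
  have d1 : (Matrix.of elim).det = ∏ i, elim i i :=
    Matrix.det_of_isLowerTriangular _ fun i j hij => h1 i j hij
  have d2 : (Matrix.of elim * Matrix.of approx).det = ∏ i, ∑ k, elim i k * approx k i :=
    Matrix.det_of_isUpperTriangular fun i j hij => h2 i j hij
  rw [Matrix.det_mul, d1, ← h3] at d2
  exact mul_left_cancel₀ h4 d2

theorem abs_height_hints_le {H : E₁.toAffine.Point → ℝ} (hH : IsCanonicalHeight H) (i j : Fin 8) :
    |H (if i = j then ptsE₁ i else ptsE₁ i + ptsE₁ j) / Real.log 2 - hints i j / 4 ^ 48|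
      ≤ 1600 / 4 ^ 48 := by
  have hr := run_sumX i j
  split_ifs with hij
  · obtain ⟨h, e⟩ := ptsE₁_eq i
    rw [sumX, if_pos hij] at hr
    rw [e]
    exact abs_height_sub_le hH h hr
  · obtain ⟨y, h, e⟩ := ptsE₁_add i j hij
    rw [e]
    exact abs_height_sub_le hH h hr

theorem abs_heightMatrix_sub_le {H : E₁.toAffine.Point → ℝ} (hH : IsCanonicalHeight H)
    (i j : Fin 8) :
    |heightMatrix H ptsE₁ i j / Real.log 2 - approx i j / (2 * 4 ^ 48)| ≤ 2400 / 4 ^ 48 := by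
  have h := abs_le.mp (abs_height_hints_le hH i j)
  have hi := abs_le.mp (abs_height_hints_le hH i i)
  have hj := abs_le.mp (abs_height_hints_le hH j j)
  rw [if_pos rfl] at hi hj
  have e4 : (1600 : ℝ) / 4 ^ 48 = 1600 * (1 / 4 ^ 48) := by ring
  have e5 : (2400 : ℝ) / 4 ^ 48 = 2400 * (1 / 4 ^ 48) := by ring
  have hp : (0 : ℝ) < 1 / 4 ^ 48 := by positivity
  by_cases hij : i = j
  · subst hij
    rw [hH.heightMatrix_self]
    have e : (approx i i : ℝ) / (2 * 4 ^ 48) = hints i i / 4 ^ 48 := by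
      simp only [approx, if_true]; push_cast; ring
    rw [e, abs_le]
    constructor <;> linarith
  · rw [if_neg hij] at h
    have e : (approx i j : ℝ) / (2 * 4 ^ 48)
        = (hints i j / 4 ^ 48 - hints i i / 4 ^ 48 - hints j j / 4 ^ 48) / 2 := by
      simp only [approx, if_neg hij]; push_cast; ring
    have e2 : heightMatrix H ptsE₁ i j / Real.log 2
        = (H (ptsE₁ i + ptsE₁ j) / Real.log 2 - H (ptsE₁ i) / Real.log 2
          - H (ptsE₁ j) / Real.log 2) / 2 := by
      simp only [heightMatrix, Matrix.of_apply]; ring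
    rw [e, e2, abs_le]
    constructor <;> linarith

theorem log_two_mem_Ioo :
    Real.log 2 ∈ Set.Ioo (0.693147180559945309 : ℝ) 0.69314718055994531 := by
  have t : |(2⁻¹ : ℝ)| = 2⁻¹ := by rw [abs_of_pos]; norm_num
  have z := Real.abs_log_sub_add_sum_range_le (show |(2⁻¹ : ℝ)| < 1 by rw [t]; norm_num) 64
  rw [t, show (1 - 2⁻¹ : ℝ) = 2⁻¹ by norm_num, Real.log_inv, ← sub_eq_add_neg, abs_le] at z
  norm_num [Finset.sum_range_succ] at z
  constructor <;> linarith [z.1, z.2]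

theorem abs_det_heightMatrix_sub_lt {H : E₁.toAffine.Point → ℝ} (hH : IsCanonicalHeight H) :
    |(heightMatrix H ptsE₁).det - 124079248627.08| < 0.01 := by
  obtain ⟨l1, l2⟩ := log_two_mem_Ioo
  have hl : 0 < Real.log 2 := Real.log_pos one_lt_two
  set A : Matrix (Fin 8) (Fin 8) ℝ := (Real.log 2)⁻¹ • heightMatrix H ptsE₁ with hA
  set B : Matrix (Fin 8) (Fin 8) ℝ := (2 * 4 ^ 48 : ℝ)⁻¹ • (Matrix.of approx).map (Int.cast)
    with hB
  have dA : (heightMatrix H ptsE₁).det = Real.log 2 ^ 8 * A.det := by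
    rw [hA, Matrix.det_smul, Fintype.card_fin, ← mul_assoc, ← mul_pow, mul_inv_cancel₀ hl.ne',
      one_pow, one_mul]
  have dB : B.det = 925490791180514743866784288203136742207753600493276888711201887982128527660871959013033794542840120695043216918948791902651590075611068609650275669398453213894985043702872349372624738083295456404422752894785321805217656686410709705793669011401745 / (2 * 4 ^ 48) ^ 8 := by
    have := Int.cast_det (R := ℝ) (Matrix.of approx)
    rw [det_approx] at this
    rw [hB, Matrix.det_smul, Fintype.card_fin]
    erw [← this]
    rw [inv_pow, inv_mul_eq_div]
    norm_num
  have hAB : ∀ i j, |A i j - B i j| ≤ 2400 / 4 ^ 48 := by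
    intro i j
    have := abs_heightMatrix_sub_le hH i j
    rwa [div_eq_inv_mul, div_eq_inv_mul (approx i j : ℝ)] at this
  have hb : ∀ i j, |approx i j| ≤ 63 * (2 * 4 ^ 48) := by decide +kernel
  have hB' : ∀ i j, |B i j| ≤ 63 := by
    intro i j
    have : (|approx i j| : ℝ) ≤ 63 * (2 * 4 ^ 48) := by exact_mod_cast hb i j
    have e : B i j = approx i j / (2 * 4 ^ 48) := by rw [div_eq_inv_mul]; rfl
    rw [e, abs_div, abs_of_pos (a := (2 * 4 ^ 48 : ℝ)) (by positivity)]
    exact (div_le_iff₀ (by positivity)).mpr this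
  have hA' : ∀ i j, |A i j| ≤ 64 := by
    intro i j
    have h1 := abs_sub_abs_le_abs_sub (A i j) (B i j)
    have h2 := hAB i j
    have h3 := hB' i j
    have h4 : (2400 : ℝ) / 4 ^ 48 ≤ 1 := by norm_num
    linarith
  have hd := abs_det_sub_det_le (by norm_num) hA' (fun i j => (hB' i j).trans (by norm_num)) hAB
  have hd' : |A.det - B.det| ≤ 1 / 10 ^ 5 := hd.trans (by norm_num [Nat.factorial])
  rw [dB, abs_le] at hd'
  have lo : (0.693147180559945309 : ℝ) ^ 8 * (925490791180514743866784288203136742207753600493276888711201887982128527660871959013033794542840120695043216918948791902651590075611068609650275669398453213894985043702872349372624738083295456404422752894785321805217656686410709705793669011401745 / (2 * 4 ^ 48) ^ 8 - 1 / 10 ^ 5)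
      ≤ Real.log 2 ^ 8 * A.det := by
    refine mul_le_mul (by gcongr) (by linarith) ?_ (by positivity)
    norm_num
  have hi : Real.log 2 ^ 8 * A.det
      ≤ (0.69314718055994531 : ℝ) ^ 8 * (925490791180514743866784288203136742207753600493276888711201887982128527660871959013033794542840120695043216918948791902651590075611068609650275669398453213894985043702872349372624738083295456404422752894785321805217656686410709705793669011401745 / (2 * 4 ^ 48) ^ 8 + 1 / 10 ^ 5) := by
    refine mul_le_mul (by gcongr) (by linarith) ?_ (by positivity)
    have : (0 : ℝ) ≤ 925490791180514743866784288203136742207753600493276888711201887982128527660871959013033794542840120695043216918948791902651590075611068609650275669398453213894985043702872349372624738083295456404422752894785321805217656686410709705793669011401745 / (2 * 4 ^ 48) ^ 8 - 1 / 10 ^ 5 := by norm_num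
    linarith
  rw [dA, abs_lt]
  constructor
  · refine lt_sub_iff_add_lt.mpr (lt_of_lt_of_le ?_ lo)
    norm_num
  · refine sub_lt_iff_lt_add.mpr (lt_of_le_of_lt hi ?_)
    norm_num

end

end RankEight

theorem mainTheorem3 [DecidableEq (RatFunc ℚ)] :
    -- the zeros of `B² - 4AC`
    (RankEight.coefB ^ 2 - 4 * RankEight.coefA * RankEight.coefC : Polynomial ℚ)
        = ∏ i : Fin 7, (Polynomial.X - Polynomial.C (RankEight.roots i)) ∧
    -- the eight points lie on the curve over `ℚ(T)`
    RankEight.OnCurve (RatFunc.X : RatFunc ℚ) 0 (12 * RatFunc.X) ∧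
    (∀ x ∈ ({1, -1, 4, -4, 9, -9, 16} : Finset (RatFunc ℚ)),
      RankEight.OnCurve RatFunc.X x
        (x ^ 2 * (RatFunc.X ^ 2 + Polynomial.aeval x RankEight.coefB / (2 * x ^ 4)))) ∧
    -- the curve is equivalent to its Weierstrass model
    Function.Bijective (RankEight.toPoint (t := (RatFunc.X : RatFunc ℚ))) ∧
    -- the eight points are independent, and the rank over `ℚ(T)` is at least eight
    LinearIndependent ℤ
      (fun i : Fin 8 => RankEight.toPoint (RankEight.pts (RatFunc.X : RatFunc ℚ) i)) ∧
    (8 : Cardinal) ≤ Module.rank ℤ (RankEight.model (RatFunc.X : RatFunc ℚ)).toAffine.Point ∧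
    -- at `T = 1` the curve is equivalent to its Weierstrass model, which has minimal model `E₁`
    Function.Bijective (RankEight.toPoint (t := (1 : ℚ))) ∧
    RankEight.changeToE₁ • RankEight.model (1 : ℚ) = RankEight.E₁ ∧
    RankEight.E₁.IsIntegral ℤ ∧
    (∀ (p : ℕ) [Fact p.Prime],
      (RankEight.E₁.map (algebraMap ℚ ℚ_[p])).IsMinimal ℤ_[p]) ∧
    -- the specialized points are independent on `E₁`, with the stated height determinant
    LinearIndependent ℤ RankEight.ptsE₁ ∧
    ∃ H : RankEight.E₁.toAffine.Point → ℝ, RankEight.IsCanonicalHeight H ∧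
      |(RankEight.heightMatrix H RankEight.ptsE₁).det - 124079248627.08| < 0.01 := by
  obtain ⟨H, hH⟩ := RankEight.exists_isCanonicalHeight RankEight.E₁
  have hdet := RankEight.abs_det_heightMatrix_sub_lt hH
  have hli : LinearIndependent ℤ RankEight.ptsE₁ := by
    refine hH.linearIndependent fun h => ?_
    rw [h] at hdet
    norm_num at hdet
  have hgen := RankEight.linearIndependent_generic hli
  refine ⟨RankEight.coefB_sq_sub, RankEight.onCurve_S _, RankEight.onCurve_of_mem,
    RankEight.toPoint_bijective _, hgen, ?_, RankEight.toPoint_bijective _,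
    RankEight.changeToE₁_smul, RankEight.E₁_isIntegral, fun p _ => RankEight.E₁_isMinimal p,
    hli, H, hH, hdet⟩
  simpa using hgen.cardinal_lift_le_rank
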